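/- Let $\mathbf E,\mathbf B:\mathbb R\times\mathbb R^3\to\mathbb R^3$ be $C^1$ fields solving Maxwell's equations in free space (units $c=1$) on all of space-time, $$\partial_t\mathbf E=\nabla\times\mathbf B,\qquad \partial_t\mathbf B=-\nabla\times\mathbf E,\qquad \nabla\cdot\mathbf E=\nabla\cdot\mathbf B=0,$$ with initial data $\mathbf E|_{t=0}=\mathbf E_0$, $\mathbf B|_{t=0}=\mathbf B_0$ that are real-analytic vector fields on $\mathbb R^3$. Assume that the initial normalized Poynting field $\mathbf V_0=(\mathbf E_0\times\mathbf B_0)/W_0$, where $W_0=\tfrac12(\mathbf E_0\cdot\mathbf E_0+\mathbf B_0\cdot\mathbf B_0)$, is well defined and smooth everywhere, in the sense that $\mathbf V_0:\mathbb R^3\to\mathbb R^3$ is a $C^\infty$ vector field with $W_0\mathbf V_0=\mathbf E_0\times\mathbf B_0$ on $\mathbb R^3$ (at points where $W_0$ vanishes, $\mathbf V_0$ is thus a smooth extension of the quotient). Then the electromagnetic field is null on all of space-time, that is, $$\mathbf E\cdot\mathbf B=0\quad\text{and}\quad \mathbf E\cdot\mathbf E=\mathbf B\cdot\mathbf B\qquad\text{for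 all }(t,x)\in\mathbb R\times\mathbb R^3,$$ if and only if the initial data satisfy, everywhere on $\mathbb R^3$, 1. (divergence-free) $\nabla\cdot\mathbf E_0=\nabla\cdot\mathbf B_0=0$; 2. (null) $\mathbf E_0\cdot\mathbf B_0=0$ and $\mathbf E_0\cdot\mathbf E_0=\mathbf B_0\cdot\mathbf B_0$; 3. (shear-free) $\sum_{i,j}(E_0^iE_0^j-B_0^iB_0^j)\,\partial_jV_{0,i}=0$ and $\sum_{i,j}(E_0^iB_0^j+E_0^jB_0^i)\,\partial_jV_{0,i}=0$. -/

import Mathlib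

open scoped Matrix ContDiff

namespace Maxwell

/-- Points and vectors of `ℝ³`. Only the dot product `⬝ᵥ` and the cross product `⨯₃` are used on it;
no norm enters the statements. -/
abbrev Vec3 : Type := Fin 3 → ℝ

noncomputable section

/-- The partial derivative `∂_j X_i` of a vector field `X` on `ℝ³`. -/
def pderiv (X : Vec3 → Vec3) (j i : Fin 3) (x : Vec3) : ℝ :=
  fderiv ℝ X x (Pi.single j 1) i

/-- The divergence `∇ · X`. -/
def divergence (X : Vec3 → Vec3) (x : Vec3) : ℝ :=
  ∑ i, pderiv X i i x

/-- The curl `∇ × X`. -/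
def curl (X : Vec3 → Vec3) (x : Vec3) : Vec3 :=
  ![pderiv X 1 2 x - pderiv X 2 1 x,
    pderiv X 2 0 x - pderiv X 0 2 x,
    pderiv X 0 1 x - pderiv X 1 0 x]

/-- Classical (jointly `C¹`) solutions on all of space-time `ℝ × ℝ³` of Maxwell's equations in free
space, in units where `c = 1`. -/
structure IsMaxwellSolution (E B : ℝ → Vec3 → Vec3) : Prop where
  contDiff_E : ContDiff ℝ 1 (fun p : ℝ × Vec3 => E p.1 p.2)
  contDiff_B : ContDiff ℝ 1 (fun p : ℝ × Vec3 => B p.1 p.2)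
  ampere : ∀ t x, deriv (fun s => E s x) t = curl (B t) x
  faraday : ∀ t x, deriv (fun s => B s x) t = -curl (E t) x
  gauss_E : ∀ t x, divergence (E t) x = 0
  gauss_B : ∀ t x, divergence (B t) x = 0

/-- The energy density `W = (E · E + B · B) / 2`. -/
def energyDensity (E B : Vec3 → Vec3) (x : Vec3) : ℝ :=
  (E x ⬝ᵥ E x + B x ⬝ᵥ B x) / 2

/-- `V` is a normalized Poynting field `(E × B) / W` of `E`, `B`, defined and smooth on all of `ℝ³`.
The relation is written as `W V = E × B`, so that `V` is the quotient wherever `W ≠ 0`, while at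
zeros of `W` it is only required that `V` extends the quotient smoothly. -/
structure IsNormalizedPoynting (E B V : Vec3 → Vec3) : Prop where
  smooth : ContDiff ℝ ∞ V
  energyDensity_smul : ∀ x, energyDensity E B x • V x = E x ⨯₃ B x

/-- The null conditions `E · B = 0`, `E · E = B · B` everywhere on `ℝ³`. -/
def IsNull (E B : Vec3 → Vec3) : Prop :=
  ∀ x, E x ⬝ᵥ B x = 0 ∧ E x ⬝ᵥ E x = B x ⬝ᵥ B x

/-- The shear-free conditions `(EⁱEʲ - BⁱBʲ) ∂_j V_i = 0` and `(EⁱBʲ + EʲBⁱ) ∂_j V_i = 0`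
everywhere on `ℝ³`. -/
def IsShearFree (E B V : Vec3 → Vec3) : Prop :=
  ∀ x,
    ∑ i, ∑ j, (E x i * E x j - B x i * B x j) * pderiv V j i x = 0 ∧
    ∑ i, ∑ j, (E x i * B x j + E x j * B x i) * pderiv V j i x = 0

end

end Maxwell

/-! Put `F = E + iB`. Maxwell's equations become `∂ₜF = -i curl F`, `div F = 0`, and the field is
null exactly when `N = F·F = |E|² - |B|² + 2i E·B` vanishes.

For null data, differentiating `V·E = V·B = 0` and the null conditions turns the two shear sums into
`E·curl B + B·curl E` and `B·curl B - E·curl E` (`Maxwell.shear_eq`). By Maxwell's equations these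
are half of `∂ₜ(|E|² - |B|²)` and `∂ₜ(E·B)`, so the shear-free condition says exactly that `∂ₜN = 0`
at time zero. Necessity follows at once.

For sufficiency, `N` is shown to solve a linear wave equation. With spinor components `φ₀, φ₁, φ₂`
of `F` one has `N = φ₁² - φ₀φ₂`, and Maxwell's equations give `φ₀² □N = (linear in ∂N and N)` with
analytic coefficients (`Maxwell.null_wave_identity`). Since `N` and `∂ₜN` vanish initially, the
equation recursively kills all time derivatives of `N` over the open set where `φ₀ ≠ 0` initially
(`Maxwell.eq_zero_of_linear_wave`), and analyticity spreads `N = 0` to all of space-time.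

This needs a space-time analytic field, whereas the solution is only assumed `C¹`. Kirchhoff's
spherical means produce an analytic solution with the same data
(`Maxwell.isEvolution_kirchhoffField`), and an energy estimate on truncated cones shows that `C¹`
solutions are determined by their data (`Maxwell.IsEvolution.eq_zero`), so the two coincide. -/

open MeasureTheory Set Filter Topology Interval

/-! ### Integrals with a parameter: analyticity and differentiation. -/

section ParametricIntegral

variable {X F : Type*} [NormedAddCommGroup X] [NormedSpace ℝ X]
  [NormedAddCommGroup F] [NormedSpace ℝ F]

/-- The linear map `(y, s) ↦ (y, τ s)`. -/
noncomputable def scaleSnd (X : Type*) [NormedAddCommGroup X] [NormedSpace ℝ X] (τ : ℝ) :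
    X × ℝ →L[ℝ] X × ℝ :=
  (ContinuousLinearMap.fst ℝ X ℝ).prod (τ • ContinuousLinearMap.snd ℝ X ℝ)

theorem scaleSnd_apply (τ : ℝ) (y : X × ℝ) : scaleSnd X τ y = (y.1, τ * y.2) := rfl

theorem continuous_scaleSnd : Continuous (scaleSnd X) := by
  have : scaleSnd X = fun τ => (ContinuousLinearMap.inl ℝ X ℝ).comp (ContinuousLinearMap.fst ℝ X ℝ)
      + τ • (ContinuousLinearMap.inr ℝ X ℝ).comp (ContinuousLinearMap.snd ℝ X ℝ) := by
    ext τ y <;> simp [scaleSnd]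
  rw [this]
  fun_prop

theorem norm_scaleSnd_apply_le {τ : ℝ} (hτ : τ ∈ Icc (0 : ℝ) 1) (y : X × ℝ) :
    ‖scaleSnd X τ y‖ ≤ ‖y‖ := by
  rw [scaleSnd_apply, Prod.norm_def, Prod.norm_def]
  refine max_le_max le_rfl ?_
  rw [norm_mul, Real.norm_of_nonneg hτ.1]
  exact mul_le_of_le_one_left (norm_nonneg _) hτ.2

theorem norm_scaleSnd_le {τ : ℝ} (hτ : τ ∈ Icc (0 : ℝ) 1) : ‖scaleSnd X τ‖ ≤ 1 :=
  ContinuousLinearMap.opNorm_le_bound _ zero_le_one fun y => by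
    simpa using norm_scaleSnd_apply_le hτ y

theorem norm_compContinuousLinearMap_scaleSnd_le {n : ℕ}
    (p : ContinuousMultilinearMap ℝ (fun _ : Fin n => X × ℝ) F) {τ : ℝ} (hτ : τ ∈ Icc (0 : ℝ) 1) :
    ‖p.compContinuousLinearMap fun _ => scaleSnd X τ‖ ≤ ‖p‖ := by
  refine (p.norm_compContinuousLinearMap_le _).trans ?_
  refine mul_le_of_le_one_right (norm_nonneg _) ?_
  exact Finset.prod_le_one (fun _ _ => norm_nonneg _) fun _ _ => norm_scaleSnd_le hτ

theorem continuous_compContinuousLinearMap_scaleSnd {n : ℕ}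
    (p : ContinuousMultilinearMap ℝ (fun _ : Fin n => X × ℝ) F) :
    Continuous fun τ => p.compContinuousLinearMap fun _ => scaleSnd X τ := by
  have h := (ContinuousMultilinearMap.compContinuousLinearMapContinuousMultilinear ℝ
    (fun _ : Fin n => X × ℝ) (fun _ : Fin n => X × ℝ) F).cont
  have h2 : Continuous fun τ : ℝ => fun _ : Fin n => scaleSnd X τ :=
    continuous_pi fun _ => continuous_scaleSnd
  exact (h.comp h2).clm_apply continuous_const

/-- For `τ ∈ [0, 1]` the map `scaleSnd X τ` has norm at most one, so composing the Taylor series of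
`g` with it and integrating in `τ` enlarges no coefficient and the radius survives. Multiplied by
`z.2 - s₀`, the integral is `∫ g (z.1, ·)` from `s₀` to `z.2`. -/
theorem AnalyticAt.integral_scaleSnd [CompleteSpace F] {g : X × ℝ → F} {x₀ : X} {s₀ : ℝ}
    (hg : AnalyticAt ℝ g (x₀, s₀)) :
    AnalyticAt ℝ (fun z : X × ℝ => ∫ τ in (0 : ℝ)..1, g (z.1, s₀ + τ * (z.2 - s₀))) (x₀, s₀) := by
  obtain ⟨p, r, hp⟩ := hg
  let q : FormalMultilinearSeries ℝ (X × ℝ) F := fun n =>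
    ∫ τ in (0 : ℝ)..1, (p n).compContinuousLinearMap fun _ => scaleSnd X τ
  have hI : ∀ τ ∈ Ι (0 : ℝ) 1, τ ∈ Icc (0 : ℝ) 1 := by
    intro τ hτ
    rw [uIoc_of_le zero_le_one] at hτ
    exact ⟨hτ.1.le, hτ.2⟩
  have hq : ∀ n, ‖q n‖ ≤ ‖p n‖ := by
    intro n
    refine (intervalIntegral.norm_integral_le_of_norm_le_const (C := ‖p n‖) ?_).trans (by simp)
    exact fun τ hτ => norm_compContinuousLinearMap_scaleSnd_le (p n) (hI τ hτ)
  have hr : p.radius ≤ q.radius := FormalMultilinearSeries.radius_le_of_le (fun n => by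
    simpa using hq n)
  refine ⟨q, r, hp.r_le.trans hr, hp.r_pos, fun {y} hy => ?_⟩
  have hqn : ∀ n, q n (fun _ => y) = ∫ τ in (0 : ℝ)..1, p n fun _ => scaleSnd X τ y := by
    intro n
    have := (ContinuousMultilinearMap.apply ℝ (fun _ : Fin n => X × ℝ) F
      (fun _ => y)).intervalIntegral_comp_comm
      ((continuous_compContinuousLinearMap_scaleSnd (p n)).intervalIntegrable (μ := volume) 0 1)
    exact this.symm
  simp_rw [hqn]
  refine intervalIntegral.hasSum_integral_of_dominated_convergence
    (fun n _ => ‖p n‖ * ‖y‖ ^ n) ?_ ?_ ?_ ?_ ?_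
  · intro n
    refine Continuous.aestronglyMeasurable ?_
    have h1 : Continuous fun τ => scaleSnd X τ y := continuous_scaleSnd.clm_apply continuous_const
    exact (p n).cont.comp (continuous_pi fun _ => h1)
  · intro n
    refine ae_of_all _ fun τ hτ => ?_
    refine ((p n).le_opNorm _).trans ?_
    simp only [Finset.prod_const, Finset.card_univ, Fintype.card_fin]
    gcongr
    exact norm_scaleSnd_apply_le (hI τ hτ) y
  · refine ae_of_all _ fun τ hτ => ?_
    have h2 : (‖y‖₊ : ENNReal) < p.radius := by
      refine lt_of_lt_of_le ?_ hp.r_le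
      simpa [enorm_eq_nnnorm] using hy
    simpa using p.summable_norm_mul_pow h2
  · simp
  · refine ae_of_all _ fun τ hτ => ?_
    have h3 : scaleSnd X τ y ∈ Metric.eball (0 : X × ℝ) r := by
      simp only [Metric.mem_eball, edist_zero_right] at hy ⊢
      refine lt_of_le_of_lt ?_ hy
      rw [← ofReal_norm, ← ofReal_norm]
      exact ENNReal.ofReal_le_ofReal (norm_scaleSnd_apply_le (hI τ hτ) y)
    have := hp.hasSum h3
    simpa [scaleSnd_apply] using this

/-- An integral over an interval of an analytic function depends analytically on the parameter. -/
theorem AnalyticOnNhd.parametric_intervalIntegral [CompleteSpace F] {g : X × ℝ → F}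
    (hg : AnalyticOnNhd ℝ g univ) (a b : ℝ) :
    AnalyticOnNhd ℝ (fun x => ∫ s in a..b, g (x, s)) univ := by
  intro x₀ _
  have hcont : Continuous g := continuousOn_univ.1 hg.continuousOn
  have hgInt : ∀ x c d, IntervalIntegrable (fun s => g (x, s)) volume c d := fun x c d =>
    (hcont.comp (by fun_prop : Continuous fun s => (x, s))).intervalIntegrable c d
  have hloc : ∀ s₀, ∀ᶠ s in 𝓝 s₀, AnalyticAt ℝ (fun x => ∫ σ in s₀..s, g (x, σ)) x₀ := by
    intro s₀
    have h1 : AnalyticAt ℝ (fun z : X × ℝ =>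
        (z.2 - s₀) • ∫ τ in (0 : ℝ)..1, g (z.1, s₀ + τ * (z.2 - s₀))) (x₀, s₀) :=
      (analyticAt_snd.sub analyticAt_const).smul (hg _ (mem_univ _)).integral_scaleSnd
    have h2 : Tendsto (fun s : ℝ => (x₀, s)) (𝓝 s₀) (𝓝 (x₀, s₀)) :=
      (by fun_prop : Continuous fun s : ℝ => (x₀, s)).tendsto s₀
    filter_upwards [h2.eventually h1.eventually_analyticAt] with s hs
    have h3 : AnalyticAt ℝ (fun x : X => (x, s)) x₀ := analyticAt_id.prod analyticAt_const
    have h4 := AnalyticAt.fun_comp (f := fun x : X => (x, s)) (x := x₀) hs h3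
    refine h4.congr (Eventually.of_forall fun x => ?_)
    have := intervalIntegral.smul_integral_comp_add_mul (a := 0) (b := 1)
      (fun σ => g (x, σ)) (s - s₀) s₀
    simp only [mul_zero, add_zero, mul_one, add_sub_cancel] at this
    simp only [← this, mul_comm]
  -- By `hloc`, moving the endpoint slightly neither creates nor destroys analyticity at `x₀`, so
  -- this set of endpoints is clopen in `ℝ`; it contains `a`.
  let S : Set ℝ := {s | AnalyticAt ℝ (fun x => ∫ σ in a..s, g (x, σ)) x₀}
  have hS : IsClopen S := by
    refine ⟨⟨isOpen_iff_mem_nhds.2 fun s₀ hs₀ => ?_⟩, isOpen_iff_mem_nhds.2 fun s₀ hs₀ => ?_⟩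
    · filter_upwards [hloc s₀] with s hs hsS
      refine hs₀ ?_
      refine (hsS.sub hs).congr (Eventually.of_forall fun x => ?_)
      simp only [Pi.sub_apply]
      rw [← intervalIntegral.integral_add_adjacent_intervals (hgInt x a s₀) (hgInt x s₀ s),
        add_sub_cancel_right]
    · filter_upwards [hloc s₀] with s hs
      refine (AnalyticAt.add hs₀ hs).congr (Eventually.of_forall fun x => ?_)
      simp only [Pi.add_apply]
      rw [intervalIntegral.integral_add_adjacent_intervals (hgInt x a s₀) (hgInt x s₀ s)]
  have hne : S.Nonempty := ⟨a, by simpa [S] using analyticAt_const⟩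
  have : b ∈ S := by rw [hS.eq_univ hne]; trivial
  exact this

/-- Differentiation under the integral sign over a compact set. -/
theorem ContDiff.hasFDerivAt_setIntegral {Y : Type*} [NormedAddCommGroup Y] [NormedSpace ℝ Y]
    [MeasurableSpace Y] [BorelSpace Y] [SecondCountableTopology Y] {μ : Measure Y}
    [IsLocallyFiniteMeasure μ] [ProperSpace X] {g : X × Y → F} (hg : ContDiff ℝ 1 g)
    {K : Set Y} (hK : IsCompact K) (x₀ : X) :
    HasFDerivAt (fun x => ∫ y in K, g (x, y) ∂μ)
      (∫ y in K, (fderiv ℝ g (x₀, y)).comp (ContinuousLinearMap.inl ℝ X Y) ∂μ) x₀ := by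
  have hc : Continuous g := hg.continuous
  have hc' : Continuous fun z => (fderiv ℝ g z).comp (ContinuousLinearMap.inl ℝ X Y) :=
    (hg.continuous_fderiv one_ne_zero).clm_comp continuous_const
  obtain ⟨M, hM⟩ := ((isCompact_closedBall x₀ 1).prod hK).bddAbove_image hc'.norm.continuousOn
  refine hasFDerivAt_integral_of_dominated_of_fderiv_le (bound := fun _ => M)
    (F' := fun x y => (fderiv ℝ g (x, y)).comp (ContinuousLinearMap.inl ℝ X Y))
    (Metric.closedBall_mem_nhds x₀ one_pos) ?_ ?_ ?_ ?_ ?_ ?_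
  · exact Eventually.of_forall fun x => (hc.comp (by fun_prop)).aestronglyMeasurable
  · exact (hc.comp (by fun_prop : Continuous fun y => (x₀, y))).continuousOn.integrableOn_compact hK
  · exact (hc'.comp (by fun_prop : Continuous fun y => (x₀, y))).aestronglyMeasurable
  · refine (ae_restrict_iff' hK.measurableSet).2 (ae_of_all _ fun y hy x hx => ?_)
    exact hM (mem_image_of_mem _ (mk_mem_prod hx hy))
  · exact integrableOn_const hK.measure_ne_top
  · refine ae_of_all _ fun y x _ => ?_
    have h1 : HasFDerivAt (fun x : X => (x, y)) (ContinuousLinearMap.inl ℝ X Y) x :=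
      hasFDerivAt_prodMk_left x y
    exact ((hg.differentiable one_ne_zero (x, y)).hasFDerivAt).comp x h1

theorem ContDiff.fderiv_intervalIntegral_apply [CompleteSpace F] [ProperSpace X] {g : X × ℝ → F}
    (hg : ContDiff ℝ 1 g) {a b : ℝ} (hab : a ≤ b) (x v : X) :
    fderiv ℝ (fun x => ∫ s in a..b, g (x, s)) x v = ∫ s in a..b, fderiv ℝ g (x, s) (v, 0) := by
  have h := hg.hasFDerivAt_setIntegral (μ := volume) (isCompact_Icc (a := a) (b := b)) x
  have hc' : Continuous fun s : ℝ =>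
      (fderiv ℝ g (x, s)).comp (ContinuousLinearMap.inl ℝ X ℝ) :=
    ((hg.continuous_fderiv one_ne_zero).comp (by fun_prop)).clm_comp continuous_const
  simp only [intervalIntegral.integral_of_le hab, ← integral_Icc_eq_integral_Ioc]
  rw [h.fderiv, ContinuousLinearMap.integral_apply]
  · rfl
  · exact hc'.continuousOn.integrableOn_compact isCompact_Icc

end ParametricIntegral

namespace Maxwell

noncomputable section

/-! ### Kirchhoff's spherical means and the wave equation. -/

section Kirchhoff

open Real

/-- Time derivative of a function on space-time. -/
def dt {G : Type*} [NormedAddCommGroup G] [NormedSpace ℝ G] (g : ℝ × Vec3 → G) (p : ℝ × Vec3) : G :=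
  fderiv ℝ g p (1, 0)

/-- Spatial partial derivative of a function on space-time. -/
def dx {G : Type*} [NormedAddCommGroup G] [NormedSpace ℝ G] (j : Fin 3) (g : ℝ × Vec3 → G)
    (p : ℝ × Vec3) : G :=
  fderiv ℝ g p (0, Pi.single j 1)

/-- Partial derivative of a scalar function on space. -/
def spd (j : Fin 3) (f : Vec3 → ℝ) (x : Vec3) : ℝ :=
  fderiv ℝ f x (Pi.single j 1)

theorem contDiff_spd {f : Vec3 → ℝ} (hf : ContDiff ℝ ω f) (j : Fin 3) :
    ContDiff ℝ ω (spd j f) := by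
  unfold spd
  fun_prop

theorem fderiv_eq_sum_spd (f : Vec3 → ℝ) (x v : Vec3) :
    fderiv ℝ f x v = ∑ j, v j * spd j f x := by
  have := (fderiv ℝ f x).toLinearMap.pi_apply_eq_sum_univ v
  simp only [ContinuousLinearMap.coe_coe, smul_eq_mul] at this
  rw [this]
  refine Finset.sum_congr rfl fun j _ => ?_
  congr 2
  ext i
  simp [Pi.single_apply, eq_comm]

theorem spd_comm {f : Vec3 → ℝ} (hf : ContDiff ℝ ω f) (j k : Fin 3) (x : Vec3) :
    spd j (spd k f) x = spd k (spd j f) x := by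
  have h : ∀ j k, spd j (spd k f) x = fderiv ℝ (fderiv ℝ f) x (Pi.single j 1) (Pi.single k 1) := by
    intro j k
    have hd : DifferentiableAt ℝ (fderiv ℝ f) x :=
      (hf.fderiv_right (m := ω) (by simp)).differentiable (by simp) x
    unfold spd
    rw [fderiv_clm_apply hd (by fun_prop)]
    simp
  rw [h, h]
  exact (hf.contDiffAt.isSymmSndFDerivAt (by simp)).eq _ _

/-- The point of the unit sphere with polar angle `φ` and azimuth `θ`. -/
def sphereDir (φ θ : ℝ) : Vec3 := ![sin φ * cos θ, sin φ * sin θ, cos φ]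

@[fun_prop]
theorem contDiff_sphereDir {X : Type*} [NormedAddCommGroup X] [NormedSpace ℝ X] {a b : X → ℝ}
    (ha : ContDiff ℝ ω a) (hb : ContDiff ℝ ω b) : ContDiff ℝ ω fun x => sphereDir (a x) (b x) := by
  refine contDiff_pi.2 fun j => ?_
  fin_cases j <;> simp [sphereDir] <;> fun_prop

/-- Iterated integral over the two angles. -/
def sphereIntegral (G : ((ℝ × Vec3) × ℝ) × ℝ → ℝ) (p : ℝ × Vec3) : ℝ :=
  ∫ φ in (0 : ℝ)..π, ∫ θ in (0 : ℝ)..(2 * π), G ((p, φ), θ)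

theorem contDiff_parametric_intervalIntegral {X F : Type*} [NormedAddCommGroup X]
    [NormedSpace ℝ X] [NormedAddCommGroup F] [NormedSpace ℝ F] [CompleteSpace F]
    {g : X × ℝ → F} (hg : ContDiff ℝ ω g) (a b : ℝ) :
    ContDiff ℝ ω (fun x => ∫ s in a..b, g (x, s)) :=
  contDiff_omega_iff_analyticOnNhd.2
    ((contDiff_omega_iff_analyticOnNhd.1 hg).parametric_intervalIntegral a b)

theorem contDiff_sphereIntegral {G : ((ℝ × Vec3) × ℝ) × ℝ → ℝ} (hG : ContDiff ℝ ω G) :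
    ContDiff ℝ ω (sphereIntegral G) :=
  contDiff_parametric_intervalIntegral (contDiff_parametric_intervalIntegral hG 0 (2 * π)) 0 π

theorem fderiv_sphereIntegral {G : ((ℝ × Vec3) × ℝ) × ℝ → ℝ} (hG : ContDiff ℝ ω G)
    (p v : ℝ × Vec3) :
    fderiv ℝ (sphereIntegral G) p v =
      sphereIntegral (fun q => fderiv ℝ (fun p => G ((p, q.1.2), q.2)) q.1.1 v) p := by
  have h1 : ContDiff ℝ 1 G := hG.of_le (by simp)
  have h2 : ContDiff ℝ 1 fun x : (ℝ × Vec3) × ℝ => ∫ θ in (0 : ℝ)..(2 * π), G (x, θ) :=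
    (contDiff_parametric_intervalIntegral hG 0 (2 * π)).of_le (by simp)
  unfold sphereIntegral
  rw [h2.fderiv_intervalIntegral_apply pi_nonneg]
  refine intervalIntegral.integral_congr fun φ _ => ?_
  rw [h1.fderiv_intervalIntegral_apply (by positivity)]
  refine intervalIntegral.integral_congr fun θ _ => ?_
  have hG' : HasFDerivAt G (fderiv ℝ G ((p, φ), θ)) ((p, φ), θ) :=
    (h1.differentiable one_ne_zero _).hasFDerivAt
  have hi : HasFDerivAt (fun p : ℝ × Vec3 => ((p, φ), θ))
      (((ContinuousLinearMap.id ℝ (ℝ × Vec3)).prod 0).prod 0) p :=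
    ((hasFDerivAt_id p).prodMk (hasFDerivAt_const φ p)).prodMk (hasFDerivAt_const θ p)
  have hc := hG'.comp p hi
  simp only [Function.comp_def] at hc
  exact (congrFun (congrArg DFunLike.coe hc.fderiv) v).symm

theorem sphereIntegral_congr {G H : ((ℝ × Vec3) × ℝ) × ℝ → ℝ} {p : ℝ × Vec3}
    (h : ∀ φ θ, G ((p, φ), θ) = H ((p, φ), θ)) : sphereIntegral G p = sphereIntegral H p := by
  simp only [sphereIntegral, h]

theorem sphereIntegral_add {G H : ((ℝ × Vec3) × ℝ) × ℝ → ℝ} (hG : Continuous G)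
    (hH : Continuous H) (p : ℝ × Vec3) :
    sphereIntegral (fun q => G q + H q) p = sphereIntegral G p + sphereIntegral H p := by
  have hθ : ∀ {G : ((ℝ × Vec3) × ℝ) × ℝ → ℝ}, Continuous G → ∀ φ,
      IntervalIntegrable (fun θ => G ((p, φ), θ)) volume 0 (2 * π) := fun hG φ =>
    (hG.comp (by fun_prop : Continuous fun θ : ℝ => ((p, φ), θ))).intervalIntegrable _ _
  have hφ : ∀ {G : ((ℝ × Vec3) × ℝ) × ℝ → ℝ}, Continuous G →
      IntervalIntegrable (fun φ => ∫ θ in (0 : ℝ)..(2 * π), G ((p, φ), θ)) volume 0 π := fun hG =>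
    (intervalIntegral.continuous_parametric_intervalIntegral_of_continuous'
      (f := fun φ θ => _) (by fun_prop) 0 (2 * π)).intervalIntegrable _ _
  unfold sphereIntegral
  rw [← intervalIntegral.integral_add (hφ hG) (hφ hH)]
  refine intervalIntegral.integral_congr fun φ _ => ?_
  exact intervalIntegral.integral_add (hθ hG φ) (hθ hH φ)

/-- The solution of the wave equation with vanishing initial value and initial velocity `f`:
`t` times the mean of `f` over the sphere of radius `t`. -/
def kirchhoff (f : Vec3 → ℝ) (p : ℝ × Vec3) : ℝ :=
  (4 * π)⁻¹ * sphereIntegral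
    (fun q => sin q.1.2 * (q.1.1.1 * f (q.1.1.2 + q.1.1.1 • sphereDir q.1.2 q.2))) p

theorem contDiff_kirchhoff {f : Vec3 → ℝ} (hf : ContDiff ℝ ω f) :
    ContDiff ℝ ω (kirchhoff f) := by
  exact contDiff_const.mul (contDiff_sphereIntegral (by fun_prop))

theorem hasFDerivAt_comp_line {f : Vec3 → ℝ} (hf : ContDiff ℝ ω f) (w : Vec3) (p : ℝ × Vec3) :
    HasFDerivAt (fun p : ℝ × Vec3 => f (p.2 + p.1 • w))
      ((fderiv ℝ f (p.2 + p.1 • w)).comp (ContinuousLinearMap.snd ℝ ℝ Vec3 +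
        (ContinuousLinearMap.fst ℝ ℝ Vec3).smulRight w)) p := by
  have h1 : HasFDerivAt f (fderiv ℝ f (p.2 + p.1 • w)) (p.2 + p.1 • w) :=
    (hf.differentiable (by simp) _).hasFDerivAt
  exact h1.comp p (hasFDerivAt_snd.add (hasFDerivAt_fst.smul_const w))

theorem fderiv_const_mul_apply' {g : ℝ × Vec3 → ℝ} (hg : ContDiff ℝ ω g) (c : ℝ)
    (p v : ℝ × Vec3) : fderiv ℝ (fun p => c * g p) p v = c * fderiv ℝ g p v := by
  rw [fderiv_const_mul (hg.differentiable (by simp) _)]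
  rfl

/-- Spherical means commute with translations, so spatial derivatives pass to the data. -/
theorem dx_kirchhoff {f : Vec3 → ℝ} (hf : ContDiff ℝ ω f) (j : Fin 3) :
    dx j (kirchhoff f) = kirchhoff (spd j f) := by
  ext p
  have hG : ContDiff ℝ ω fun q : ((ℝ × Vec3) × ℝ) × ℝ =>
      sin q.1.2 * (q.1.1.1 * f (q.1.1.2 + q.1.1.1 • sphereDir q.1.2 q.2)) := by fun_prop
  unfold dx kirchhoff
  rw [fderiv_const_mul_apply' (contDiff_sphereIntegral hG), fderiv_sphereIntegral hG]
  congr 1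
  refine sphereIntegral_congr fun φ θ => ?_
  have := ((hasFDerivAt_fst (p := p)).mul
    (hasFDerivAt_comp_line hf (sphereDir φ θ) p)).const_mul (sin φ)
  refine (congrFun (congrArg DFunLike.coe this.fderiv) _).trans ?_
  simp [spd]

/-- The integrand of the time derivative of `kirchhoff f`. -/
def dtKirchhoffIntegrand (f : Vec3 → ℝ) (q : ((ℝ × Vec3) × ℝ) × ℝ) : ℝ :=
  sin q.1.2 * (f (q.1.1.2 + q.1.1.1 • sphereDir q.1.2 q.2) + q.1.1.1 *
    ∑ j, sphereDir q.1.2 q.2 j * spd j f (q.1.1.2 + q.1.1.1 • sphereDir q.1.2 q.2))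

theorem contDiff_dtKirchhoffIntegrand {f : Vec3 → ℝ} (hf : ContDiff ℝ ω f) :
    ContDiff ℝ ω (dtKirchhoffIntegrand f) := by
  have h := fun j => contDiff_spd hf j
  unfold dtKirchhoffIntegrand
  fun_prop

theorem dt_kirchhoff {f : Vec3 → ℝ} (hf : ContDiff ℝ ω f) :
    dt (kirchhoff f) = fun p => (4 * π)⁻¹ * sphereIntegral (dtKirchhoffIntegrand f) p := by
  ext p
  have hG : ContDiff ℝ ω fun q : ((ℝ × Vec3) × ℝ) × ℝ =>
      sin q.1.2 * (q.1.1.1 * f (q.1.1.2 + q.1.1.1 • sphereDir q.1.2 q.2)) := by fun_prop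
  unfold dt kirchhoff
  rw [fderiv_const_mul_apply' (contDiff_sphereIntegral hG), fderiv_sphereIntegral hG]
  congr 1
  refine sphereIntegral_congr fun φ θ => ?_
  have := ((hasFDerivAt_fst (p := p)).mul
    (hasFDerivAt_comp_line hf (sphereDir φ θ) p)).const_mul (sin φ)
  refine (congrFun (congrArg DFunLike.coe this.fderiv) _).trans ?_
  simp [dtKirchhoffIntegrand, ← fderiv_eq_sum_spd]
  ring

/-- Along a ray with direction `n` the integrand is `t f(x + tn)`, whose second derivative is `2 ∂ₙf
+ t ∂ₙ²f`. -/
theorem dt_dt_kirchhoff {f : Vec3 → ℝ} (hf : ContDiff ℝ ω f) (p : ℝ × Vec3) :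
    dt (dt (kirchhoff f)) p = (4 * π)⁻¹ * sphereIntegral (fun q =>
      sin q.1.2 * (2 * ∑ j, sphereDir q.1.2 q.2 j *
          spd j f (q.1.1.2 + q.1.1.1 • sphereDir q.1.2 q.2) +
        q.1.1.1 * ∑ j, sphereDir q.1.2 q.2 j * ∑ k, sphereDir q.1.2 q.2 k *
          spd k (spd j f) (q.1.1.2 + q.1.1.1 • sphereDir q.1.2 q.2))) p := by
  have hG := contDiff_dtKirchhoffIntegrand hf
  rw [dt_kirchhoff hf]
  unfold dt
  rw [fderiv_const_mul_apply' (contDiff_sphereIntegral hG), fderiv_sphereIntegral hG]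
  congr 1
  refine sphereIntegral_congr fun φ θ => ?_
  have h2 := HasFDerivAt.fun_sum (u := Finset.univ) fun j _ =>
    (hasFDerivAt_comp_line (contDiff_spd hf j) (sphereDir φ θ) p).const_mul (sphereDir φ θ j)
  have := ((hasFDerivAt_comp_line hf (sphereDir φ θ) p).add
    ((hasFDerivAt_fst (p := p)).mul h2)).const_mul (sin φ)
  simp only [dtKirchhoffIntegrand]
  refine (congrFun (congrArg DFunLike.coe this.fderiv) _).trans ?_
  simp [← fderiv_eq_sum_spd]
  ring

theorem dx_dx_kirchhoff {f : Vec3 → ℝ} (hf : ContDiff ℝ ω f) (j : Fin 3) (p : ℝ × Vec3) :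
    dx j (dx j (kirchhoff f)) p = kirchhoff (spd j (spd j f)) p := by
  rw [dx_kirchhoff hf, dx_kirchhoff (contDiff_spd hf j)]

/-- The unit tangent vector to the meridian at `sphereDir φ θ`. -/
def polarDir (φ θ : ℝ) : Vec3 := ![cos φ * cos θ, cos φ * sin θ, -sin φ]

/-- The unit tangent vector to the parallel at `sphereDir φ θ`. -/
def azimuthDir (θ : ℝ) : Vec3 := ![-sin θ, cos θ, 0]

/-- The derivative of `azimuthDir`. -/
def azimuthDir' (θ : ℝ) : Vec3 := ![-cos θ, -sin θ, 0]

@[fun_prop]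
theorem contDiff_polarDir {X : Type*} [NormedAddCommGroup X] [NormedSpace ℝ X] {a b : X → ℝ}
    (ha : ContDiff ℝ ω a) (hb : ContDiff ℝ ω b) : ContDiff ℝ ω fun x => polarDir (a x) (b x) := by
  refine contDiff_pi.2 fun j => ?_
  fin_cases j <;> simp [polarDir] <;> fun_prop

@[fun_prop]
theorem contDiff_azimuthDir {X : Type*} [NormedAddCommGroup X] [NormedSpace ℝ X] {a : X → ℝ}
    (ha : ContDiff ℝ ω a) : ContDiff ℝ ω fun x => azimuthDir (a x) := by
  refine contDiff_pi.2 fun j => ?_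
  fin_cases j <;> simp [azimuthDir] <;> fun_prop

@[fun_prop]
theorem contDiff_azimuthDir' {X : Type*} [NormedAddCommGroup X] [NormedSpace ℝ X] {a : X → ℝ}
    (ha : ContDiff ℝ ω a) : ContDiff ℝ ω fun x => azimuthDir' (a x) := by
  refine contDiff_pi.2 fun j => ?_
  fin_cases j <;> simp [azimuthDir'] <;> fun_prop

theorem hasDerivAt_sphereDir_polar (φ θ : ℝ) :
    HasDerivAt (fun φ => sphereDir φ θ) (polarDir φ θ) φ := by
  refine hasDerivAt_pi.2 fun j => ?_
  fin_cases j
  · exact (hasDerivAt_sin φ).mul_const _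
  · exact (hasDerivAt_sin φ).mul_const _
  · exact hasDerivAt_cos φ

theorem hasDerivAt_sphereDir_azimuth (φ θ : ℝ) :
    HasDerivAt (fun θ => sphereDir φ θ) (sin φ • azimuthDir θ) θ := by
  refine hasDerivAt_pi.2 fun j => ?_
  fin_cases j
  · exact (hasDerivAt_cos θ).const_mul _
  · exact (hasDerivAt_sin θ).const_mul _
  · simpa [azimuthDir, sphereDir] using hasDerivAt_const θ (cos φ)

theorem hasDerivAt_polarDir (φ θ : ℝ) :
    HasDerivAt (fun φ => polarDir φ θ) (-sphereDir φ θ) φ := by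
  refine hasDerivAt_pi.2 fun j => ?_
  fin_cases j
  · simpa [sphereDir, polarDir] using (hasDerivAt_cos φ).mul_const (cos θ)
  · simpa [sphereDir, polarDir] using (hasDerivAt_cos φ).mul_const (sin θ)
  · exact (hasDerivAt_sin φ).neg

theorem hasDerivAt_azimuthDir (θ : ℝ) : HasDerivAt azimuthDir (azimuthDir' θ) θ := by
  refine hasDerivAt_pi.2 fun j => ?_
  fin_cases j
  · exact (hasDerivAt_sin θ).neg
  · exact hasDerivAt_cos θ
  · exact hasDerivAt_const θ (0 : ℝ)

theorem hasDerivAt_comp_spd {f : Vec3 → ℝ} (hf : ContDiff ℝ ω f) {γ : ℝ → Vec3} {γ' : Vec3} {s : ℝ}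
    (hγ : HasDerivAt γ γ' s) : HasDerivAt (fun s => f (γ s)) (∑ k, γ' k * spd k f (γ s)) s := by
  rw [← fderiv_eq_sum_spd]
  exact (hf.differentiable (by simp) _).hasFDerivAt.comp_hasDerivAt s hγ

/-- The polar part of the angular divergence. -/
def polarTerm (f : Vec3 → ℝ) (q : ((ℝ × Vec3) × ℝ) × ℝ) : ℝ :=
  cos q.1.2 * ∑ j, polarDir q.1.2 q.2 j * spd j f (q.1.1.2 + q.1.1.1 • sphereDir q.1.2 q.2) +
  sin q.1.2 * ∑ j, (-sphereDir q.1.2 q.2 j * spd j f (q.1.1.2 + q.1.1.1 • sphereDir q.1.2 q.2) +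
    polarDir q.1.2 q.2 j * ∑ k, (q.1.1.1 * polarDir q.1.2 q.2 k) *
      spd k (spd j f) (q.1.1.2 + q.1.1.1 • sphereDir q.1.2 q.2))

/-- The azimuthal part of the angular divergence. -/
def azimuthTerm (f : Vec3 → ℝ) (q : ((ℝ × Vec3) × ℝ) × ℝ) : ℝ :=
  ∑ j, (azimuthDir' q.2 j * spd j f (q.1.1.2 + q.1.1.1 • sphereDir q.1.2 q.2) +
    azimuthDir q.2 j * ∑ k, (q.1.1.1 * (sin q.1.2 * azimuthDir q.2 k)) *
      spd k (spd j f) (q.1.1.2 + q.1.1.1 • sphereDir q.1.2 q.2))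

theorem contDiff_polarTerm {f : Vec3 → ℝ} (hf : ContDiff ℝ ω f) : ContDiff ℝ ω (polarTerm f) := by
  have h1 := fun j => contDiff_spd hf j
  have h2 := fun j k => contDiff_spd (contDiff_spd hf j) k
  unfold polarTerm
  fun_prop

theorem contDiff_azimuthTerm {f : Vec3 → ℝ} (hf : ContDiff ℝ ω f) :
    ContDiff ℝ ω (azimuthTerm f) := by
  have h1 := fun j => contDiff_spd hf j
  have h2 := fun j k => contDiff_spd (contDiff_spd hf j) k
  unfold azimuthTerm
  fun_prop

/-- The integrand is the `φ`-derivative of `sin φ` times the derivative of `f` along the meridian,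
and `sin` vanishes at both poles. -/
theorem integral_polarTerm {f : Vec3 → ℝ} (hf : ContDiff ℝ ω f) (p : ℝ × Vec3) (θ : ℝ) :
    ∫ φ in (0 : ℝ)..π, polarTerm f ((p, φ), θ) = 0 := by
  have hd : ∀ φ, HasDerivAt
      (fun φ => sin φ * ∑ j, polarDir φ θ j * spd j f (p.2 + p.1 • sphereDir φ θ))
      (polarTerm f ((p, φ), θ)) φ := by
    intro φ
    have hγ : HasDerivAt (fun φ => p.2 + p.1 • sphereDir φ θ) (p.1 • polarDir φ θ) φ :=
      ((hasDerivAt_sphereDir_polar φ θ).const_smul p.1).const_add p.2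
    refine (hasDerivAt_sin φ).mul (HasDerivAt.fun_sum fun j _ => ?_)
    exact (hasDerivAt_pi.1 (hasDerivAt_polarDir φ θ) j).mul
      (hasDerivAt_comp_spd (contDiff_spd hf j) hγ)
  rw [intervalIntegral.integral_eq_sub_of_hasDerivAt fun φ _ => hd φ]
  · simp
  · exact ((contDiff_polarTerm hf).continuous.comp
      (by fun_prop : Continuous fun φ : ℝ => ((p, φ), θ))).intervalIntegrable _ _

/-- The integrand is the `θ`-derivative of a `2π`-periodic function. -/
theorem integral_azimuthTerm {f : Vec3 → ℝ} (hf : ContDiff ℝ ω f) (p : ℝ × Vec3) (φ : ℝ) :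
    ∫ θ in (0 : ℝ)..(2 * π), azimuthTerm f ((p, φ), θ) = 0 := by
  have hd : ∀ θ, HasDerivAt
      (fun θ => ∑ j, azimuthDir θ j * spd j f (p.2 + p.1 • sphereDir φ θ))
      (azimuthTerm f ((p, φ), θ)) θ := by
    intro θ
    have hγ : HasDerivAt (fun θ => p.2 + p.1 • sphereDir φ θ) (p.1 • (sin φ • azimuthDir θ)) θ :=
      ((hasDerivAt_sphereDir_azimuth φ θ).const_smul p.1).const_add p.2
    refine HasDerivAt.fun_sum fun j _ => ?_
    exact (hasDerivAt_pi.1 (hasDerivAt_azimuthDir θ) j).mul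
      (hasDerivAt_comp_spd (contDiff_spd hf j) hγ)
  rw [intervalIntegral.integral_eq_sub_of_hasDerivAt fun θ _ => hd θ]
  · simp [azimuthDir, sphereDir]
  · exact ((contDiff_azimuthTerm hf).continuous.comp
      (by fun_prop : Continuous fun θ : ℝ => ((p, φ), θ))).intervalIntegrable _ _

theorem sphereIntegral_polarTerm {f : Vec3 → ℝ} (hf : ContDiff ℝ ω f) (p : ℝ × Vec3) :
    sphereIntegral (polarTerm f) p = 0 := by
  unfold sphereIntegral
  rw [intervalIntegral_intervalIntegral_swap]
  · simp [integral_polarTerm hf]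
  · have hc : Continuous (Function.uncurry fun φ θ : ℝ => polarTerm f ((p, φ), θ)) :=
      (contDiff_polarTerm hf).continuous.comp
        (by fun_prop : Continuous fun z : ℝ × ℝ => ((p, z.1), z.2))
    exact (hc.continuousOn.integrableOn_compact (isCompact_uIcc.prod isCompact_uIcc)).mono_set
      (prod_mono uIoc_subset_uIcc uIoc_subset_uIcc)

theorem sphereIntegral_azimuthTerm {f : Vec3 → ℝ} (hf : ContDiff ℝ ω f) (p : ℝ × Vec3) :
    sphereIntegral (azimuthTerm f) p = 0 := by
  simp [sphereIntegral, integral_azimuthTerm hf]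

/-- The Laplacian in spherical coordinates, as an identity between integrands: `s = sin φ`, `c = cos
φ`, `σ = sin θ`, `κ = cos θ`, and `gⱼ`, `gⱼₖ` stand for partial derivatives of `f`. The radial part
plus the two angular divergence terms is `sin φ · t Δf`. -/
theorem spherical_laplacian_identity (s c σ κ t : ℝ) (h₁ : s ^ 2 + c ^ 2 = 1)
    (h₂ : σ ^ 2 + κ ^ 2 = 1) (g₀ g₁ g₂ g₀₀ g₀₁ g₀₂ g₁₁ g₁₂ g₂₂ : ℝ) :
    s * (2 * (s * κ * g₀ + s * σ * g₁ + c * g₂) +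
        t * (s * κ * (s * κ * g₀₀ + s * σ * g₀₁ + c * g₀₂) +
          s * σ * (s * κ * g₀₁ + s * σ * g₁₁ + c * g₁₂) +
          c * (s * κ * g₀₂ + s * σ * g₁₂ + c * g₂₂))) +
      (c * (c * κ * g₀ + c * σ * g₁ + -s * g₂) +
        s * (-(s * κ) * g₀ + c * κ *
            (t * (c * κ) * g₀₀ + t * (c * σ) * g₀₁ + t * -s * g₀₂) +
          (-(s * σ) * g₁ + c * σ * (t * (c * κ) * g₀₁ + t * (c * σ) * g₁₁ + t * -s * g₁₂)) +
          (-c * g₂ + -s * (t * (c * κ) * g₀₂ + t * (c * σ) * g₁₂ + t * -s * g₂₂)))) +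
      (-κ * g₀ + -σ * (t * (s * -σ) * g₀₀ + t * (s * κ) * g₀₁) +
        (-σ * g₁ + κ * (t * (s * -σ) * g₀₁ + t * (s * κ) * g₁₁))) =
    s * (t * (g₀₀ + g₁₁ + g₂₂)) := by
  linear_combination (κ * g₀ + σ * g₁ + s * t * (κ ^ 2 * g₀₀ + 2 * κ * σ * g₀₁ + σ ^ 2 * g₁₁)
    + s * t * g₂₂) * h₁ + s * t * (g₀₀ + g₁₁) * h₂

/-- `kirchhoff f` solves the wave equation. -/
theorem wave_kirchhoff {f : Vec3 → ℝ} (hf : ContDiff ℝ ω f) (p : ℝ × Vec3) :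
    dt (dt (kirchhoff f)) p = ∑ j, dx j (dx j (kirchhoff f)) p := by
  simp_rw [dx_dx_kirchhoff hf, dt_dt_kirchhoff hf]
  have h1 := fun j => contDiff_spd hf j
  have h2 := fun j k => contDiff_spd (contDiff_spd hf j) k
  simp only [kirchhoff, ← Finset.mul_sum]
  congr 1
  have hk : ∀ j, Continuous fun q : ((ℝ × Vec3) × ℝ) × ℝ => sin q.1.2 * (q.1.1.1 *
      spd j (spd j f) (q.1.1.2 + q.1.1.1 • sphereDir q.1.2 q.2)) := fun j =>
    (by fun_prop : ContDiff ℝ ω fun q : ((ℝ × Vec3) × ℝ) × ℝ => sin q.1.2 * (q.1.1.1 *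
      spd j (spd j f) (q.1.1.2 + q.1.1.1 • sphereDir q.1.2 q.2))).continuous
  have hI : Continuous fun q : ((ℝ × Vec3) × ℝ) × ℝ =>
      sin q.1.2 * (2 * ∑ j, sphereDir q.1.2 q.2 j *
          spd j f (q.1.1.2 + q.1.1.1 • sphereDir q.1.2 q.2) +
        q.1.1.1 * ∑ j, sphereDir q.1.2 q.2 j * ∑ k, sphereDir q.1.2 q.2 k *
          spd k (spd j f) (q.1.1.2 + q.1.1.1 • sphereDir q.1.2 q.2)) :=
    (by fun_prop : ContDiff ℝ ω fun q : ((ℝ × Vec3) × ℝ) × ℝ =>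
      sin q.1.2 * (2 * ∑ j, sphereDir q.1.2 q.2 j *
          spd j f (q.1.1.2 + q.1.1.1 • sphereDir q.1.2 q.2) +
        q.1.1.1 * ∑ j, sphereDir q.1.2 q.2 j * ∑ k, sphereDir q.1.2 q.2 k *
          spd k (spd j f) (q.1.1.2 + q.1.1.1 • sphereDir q.1.2 q.2))).continuous
  have hA := (contDiff_polarTerm hf).continuous
  have hB := (contDiff_azimuthTerm hf).continuous
  -- The angular divergence integrates to zero, so it may be added to the integrand of `∂ₜ²`; the
  -- two sides then agree pointwise.
  have e := sphereIntegral_add (hI.fun_add hA) hB p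
  rw [sphereIntegral_add hI hA, sphereIntegral_polarTerm hf, sphereIntegral_azimuthTerm hf,
    add_zero, add_zero] at e
  rw [← e, Fin.sum_univ_three, ← sphereIntegral_add (hk 0) (hk 1),
    ← sphereIntegral_add ((hk 0).fun_add (hk 1)) (hk 2)]
  refine sphereIntegral_congr fun φ θ => ?_
  have := spherical_laplacian_identity (sin φ) (cos φ) (sin θ) (cos θ) p.1 (sin_sq_add_cos_sq φ)
    (sin_sq_add_cos_sq θ)
  simp only [polarTerm, azimuthTerm, Fin.sum_univ_three]
  generalize p.2 + p.1 • sphereDir φ θ = y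
  rw [spd_comm hf 1 0, spd_comm hf 2 0, spd_comm hf 2 1]
  simp only [sphereDir, polarDir, azimuthDir, azimuthDir', Matrix.cons_val]
  linear_combination this (spd 0 f y) (spd 1 f y) (spd 2 f y) (spd 0 (spd 0 f) y)
    (spd 0 (spd 1 f) y) (spd 0 (spd 2 f) y) (spd 1 (spd 1 f) y) (spd 1 (spd 2 f) y)
    (spd 2 (spd 2 f) y)

theorem kirchhoff_zero_time (f : Vec3 → ℝ) (x : Vec3) : kirchhoff f (0, x) = 0 := by
  simp [kirchhoff, sphereIntegral]

theorem dt_kirchhoff_zero_time {f : Vec3 → ℝ} (hf : ContDiff ℝ ω f) (x : Vec3) :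
    dt (kirchhoff f) (0, x) = f x := by
  rw [dt_kirchhoff hf]
  have h : sphereIntegral (dtKirchhoffIntegrand f) (0, x) = 4 * π * f x := by
    simp [sphereIntegral, dtKirchhoffIntegrand]
    ring
  simp only [h]
  field_simp

theorem kirchhoff_add {f g : Vec3 → ℝ} (hf : ContDiff ℝ ω f) (hg : ContDiff ℝ ω g)
    (p : ℝ × Vec3) : kirchhoff (fun x => f x + g x) p = kirchhoff f p + kirchhoff g p := by
  have h : ∀ {f : Vec3 → ℝ}, ContDiff ℝ ω f → Continuous fun q : ((ℝ × Vec3) × ℝ) × ℝ =>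
      sin q.1.2 * (q.1.1.1 * f (q.1.1.2 + q.1.1.1 • sphereDir q.1.2 q.2)) := fun {f} hf =>
    (by fun_prop : ContDiff ℝ ω fun q : ((ℝ × Vec3) × ℝ) × ℝ =>
      sin q.1.2 * (q.1.1.1 * f (q.1.1.2 + q.1.1.1 • sphereDir q.1.2 q.2))).continuous
  unfold kirchhoff
  rw [← mul_add, ← sphereIntegral_add (h hf) (h hg)]
  congr 1
  refine sphereIntegral_congr fun φ θ => ?_
  ring

theorem kirchhoff_zero (p : ℝ × Vec3) : kirchhoff (fun _ => 0) p = 0 := by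
  simp [kirchhoff, sphereIntegral]

end Kirchhoff

/-! ### Calculus rules for the space-time derivatives. -/

section Derivations

variable {A : Type*} [NormedCommRing A] [NormedAlgebra ℝ A] {g h : ℝ × Vec3 → A} {p : ℝ × Vec3}

theorem dt_mul (hg : DifferentiableAt ℝ g p) (hh : DifferentiableAt ℝ h p) :
    dt (fun p => g p * h p) p = g p * dt h p + dt g p * h p := by
  simp only [dt]
  rw [fderiv_fun_mul hg hh]
  simp [mul_comm]

theorem dx_mul (j : Fin 3) (hg : DifferentiableAt ℝ g p) (hh : DifferentiableAt ℝ h p) :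
    dx j (fun p => g p * h p) p = g p * dx j h p + dx j g p * h p := by
  simp only [dx]
  rw [fderiv_fun_mul hg hh]
  simp [mul_comm]

theorem dt_add (hg : DifferentiableAt ℝ g p) (hh : DifferentiableAt ℝ h p) :
    dt (fun p => g p + h p) p = dt g p + dt h p := by
  simp only [dt]
  rw [fderiv_fun_add hg hh]
  rfl

theorem dx_add (j : Fin 3) (hg : DifferentiableAt ℝ g p) (hh : DifferentiableAt ℝ h p) :
    dx j (fun p => g p + h p) p = dx j g p + dx j h p := by
  simp only [dx]
  rw [fderiv_fun_add hg hh]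
  rfl

theorem dt_sub (hg : DifferentiableAt ℝ g p) (hh : DifferentiableAt ℝ h p) :
    dt (fun p => g p - h p) p = dt g p - dt h p := by
  simp only [dt]
  rw [fderiv_fun_sub hg hh]
  rfl

theorem dx_sub (j : Fin 3) (hg : DifferentiableAt ℝ g p) (hh : DifferentiableAt ℝ h p) :
    dx j (fun p => g p - h p) p = dx j g p - dx j h p := by
  simp only [dx]
  rw [fderiv_fun_sub hg hh]
  rfl

theorem dt_sum {ι : Type*} {s : Finset ι} {g : ι → ℝ × Vec3 → A}
    (hg : ∀ i ∈ s, DifferentiableAt ℝ (g i) p) :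
    dt (fun p => ∑ i ∈ s, g i p) p = ∑ i ∈ s, dt (g i) p := by
  simp only [dt]
  rw [fderiv_fun_sum hg]
  simp

theorem dx_sum {ι : Type*} {s : Finset ι} {g : ι → ℝ × Vec3 → A} (j : Fin 3)
    (hg : ∀ i ∈ s, DifferentiableAt ℝ (g i) p) :
    dx j (fun p => ∑ i ∈ s, g i p) p = ∑ i ∈ s, dx j (g i) p := by
  simp only [dx]
  rw [fderiv_fun_sum hg]
  simp

theorem continuous_dt (hg : ContDiff ℝ 1 g) : Continuous (dt g) :=
  (hg.continuous_fderiv one_ne_zero).clm_apply continuous_const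

theorem continuous_dx (j : Fin 3) (hg : ContDiff ℝ 1 g) : Continuous (dx j g) :=
  (hg.continuous_fderiv one_ne_zero).clm_apply continuous_const

end Derivations

/-! ### Energy estimate and uniqueness for the evolution equations. -/

/-- Maxwell's evolution equations for the components of two `C¹` fields on space-time. -/
structure IsEvolution (e b : Fin 3 → ℝ × Vec3 → ℝ) : Prop where
  contDiff_e : ∀ i, ContDiff ℝ 1 (e i)
  contDiff_b : ∀ i, ContDiff ℝ 1 (b i)
  ampere : ∀ i p, dt (e i) p = dx (i + 1) (b (i + 2)) p - dx (i + 2) (b (i + 1)) p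
  faraday : ∀ i p, dt (b i) p = -(dx (i + 1) (e (i + 2)) p - dx (i + 2) (e (i + 1)) p)

/-- A smooth substitute for the Euclidean distance to the origin. -/
def smoothNorm (x : Vec3) : ℝ := Real.sqrt (1 + ∑ i, x i ^ 2)

theorem one_add_sum_sq_pos (x : Vec3) : 0 < 1 + ∑ i, x i ^ 2 := by positivity

theorem contDiff_smoothNorm : ContDiff ℝ 1 smoothNorm := by
  unfold smoothNorm
  exact ContDiff.sqrt (by fun_prop) fun x => (one_add_sum_sq_pos x).ne'

theorem spd_smoothNorm (j : Fin 3) (x : Vec3) :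
    spd j smoothNorm x = x j / smoothNorm x := by
  have h1 : ∀ i : Fin 3, HasFDerivAt (fun x : Vec3 => x i ^ 2)
      ((2 * x i) • ContinuousLinearMap.proj (R := ℝ) (φ := fun _ : Fin 3 => ℝ) i) x := fun i => by
    have := (hasFDerivAt_apply (𝕜 := ℝ) i x).pow 2
    simpa using this
  have h2 := ((HasFDerivAt.fun_sum fun i (_ : i ∈ Finset.univ) => h1 i).const_add 1).sqrt
    (one_add_sum_sq_pos x).ne'
  have h3 := congrFun (congrArg DFunLike.coe h2.fderiv) (Pi.single j 1)
  refine h3.trans ?_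
  simp [Pi.single_apply, smoothNorm]
  field_simp

theorem norm_le_smoothNorm (x : Vec3) : ‖x‖ ≤ smoothNorm x := by
  refine (pi_norm_le_iff_of_nonneg (Real.sqrt_nonneg _)).2 fun i => ?_
  refine Real.le_sqrt_of_sq_le ?_
  rw [Real.norm_eq_abs, sq_abs]
  have := Finset.single_le_sum (f := fun i => x i ^ 2) (fun i _ => sq_nonneg _) (Finset.mem_univ i)
  linarith

/-- The gradient bound keeps the level sets of `σ t + smoothNorm x` from being timelike, so no
energy enters the cone through its side. -/
theorem sum_sq_spd_smoothNorm_le (x : Vec3) : ∑ j, spd j smoothNorm x ^ 2 ≤ 1 := by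
  have h : 0 < smoothNorm x ^ 2 := by
    rw [smoothNorm, Real.sq_sqrt (one_add_sum_sq_pos x).le]
    exact one_add_sum_sq_pos x
  simp_rw [spd_smoothNorm, div_pow, ← Finset.sum_div]
  rw [div_le_one h, smoothNorm, Real.sq_sqrt (one_add_sum_sq_pos x).le]
  linarith

/-- The cut-off on the (future for `σ = 1`, past for `σ = -1`) domain of dependence. -/
def coneWeight (R σ : ℝ) (p : ℝ × Vec3) : ℝ := expNegInvGlue (R - σ * p.1 - smoothNorm p.2)

theorem contDiff_coneWeight (R σ : ℝ) : ContDiff ℝ 1 (coneWeight R σ) := by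
  have h := contDiff_smoothNorm
  have h2 : ContDiff ℝ 1 expNegInvGlue := expNegInvGlue.contDiff (n := 1)
  exact h2.comp (by fun_prop)

theorem fderiv_coneWeight (R σ : ℝ) (p v : ℝ × Vec3) :
    fderiv ℝ (coneWeight R σ) p v = -deriv expNegInvGlue (R - σ * p.1 - smoothNorm p.2) *
      (σ * v.1 + fderiv ℝ smoothNorm p.2 v.2) := by
  have h2 : HasDerivAt expNegInvGlue (deriv expNegInvGlue (R - σ * p.1 - smoothNorm p.2))
      (R - σ * p.1 - smoothNorm p.2) :=
    ((expNegInvGlue.contDiff (n := 1)).differentiable one_ne_zero _).hasDerivAt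
  have h3 : HasFDerivAt smoothNorm (fderiv ℝ smoothNorm p.2) p.2 :=
    (contDiff_smoothNorm.differentiable one_ne_zero _).hasFDerivAt
  have h4 := h3.comp p (hasFDerivAt_snd (𝕜 := ℝ) (E := ℝ) (F := Vec3))
  have h5 := (((hasFDerivAt_fst (𝕜 := ℝ) (E := ℝ) (F := Vec3) (p := p)).const_mul σ).const_sub
    R).sub h4
  have h6 := h2.comp_hasFDerivAt p h5
  refine (congrFun (congrArg DFunLike.coe h6.fderiv) v).trans ?_
  simp
  ring

theorem coneWeight_eq_zero {R σ : ℝ} {p : ℝ × Vec3} (h : 0 ≤ σ * p.1)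
    (hp : p.2 ∉ Metric.closedBall (0 : Vec3) R) : coneWeight R σ p = 0 := by
  refine expNegInvGlue.zero_of_nonpos ?_
  have := norm_le_smoothNorm p.2
  simp only [Metric.mem_closedBall, dist_zero_right, not_le] at hp
  linarith

/-- Twice the energy density. -/
def energyComp (e b : Fin 3 → ℝ × Vec3 → ℝ) (p : ℝ × Vec3) : ℝ :=
  ∑ i, (e i p * e i p + b i p * b i p)

/-- The components of the Poynting vector. -/
def poyntingComp (e b : Fin 3 → ℝ × Vec3 → ℝ) (j : Fin 3) (p : ℝ × Vec3) : ℝ :=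
  e (j + 1) p * b (j + 2) p - e (j + 2) p * b (j + 1) p

/-- The expression equals `|e + b × n|² + (b·n)² + |b|² (1 - |n|²)`. -/
theorem energy_add_flux_nonneg (e b n : Fin 3 → ℝ) (hn : ∑ j, n j ^ 2 ≤ 1) :
    0 ≤ ∑ i, (e i * e i + b i * b i) +
      2 * ∑ j, n j * (e (j + 1) * b (j + 2) - e (j + 2) * b (j + 1)) := by
  simp only [Fin.sum_univ_three, Fin.isValue, Fin.reduceAdd] at hn ⊢
  have hb : 0 ≤ (b 0 ^ 2 + b 1 ^ 2 + b 2 ^ 2) * (1 - (n 0 ^ 2 + n 1 ^ 2 + n 2 ^ 2)) :=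
    mul_nonneg (by positivity) (by linarith)
  nlinarith [sq_nonneg (e 0 + (b 1 * n 2 - b 2 * n 1)), sq_nonneg (e 1 + (b 2 * n 0 - b 0 * n 2)),
    sq_nonneg (e 2 + (b 0 * n 1 - b 1 * n 0)), sq_nonneg (b 0 * n 0 + b 1 * n 1 + b 2 * n 2)]

section Energy

variable {e b : Fin 3 → ℝ × Vec3 → ℝ}

theorem IsEvolution.contDiff_energyComp (h : IsEvolution e b) : ContDiff ℝ 1 (energyComp e b) := by
  have h1 := h.contDiff_e
  have h2 := h.contDiff_b
  unfold energyComp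
  fun_prop

theorem IsEvolution.contDiff_poyntingComp (h : IsEvolution e b) (j : Fin 3) :
    ContDiff ℝ 1 (poyntingComp e b j) := by
  have h1 := h.contDiff_e
  have h2 := h.contDiff_b
  unfold poyntingComp
  fun_prop

/-- Poynting's theorem; the factor is 2 because `energyComp` is `|e|² + |b|²`. -/
theorem IsEvolution.dt_energyComp (h : IsEvolution e b) (p : ℝ × Vec3) :
    dt (energyComp e b) p = -2 * ∑ j, dx j (poyntingComp e b j) p := by
  have h1 : ∀ i, DifferentiableAt ℝ (e i) p := fun i => (h.contDiff_e i).differentiable one_ne_zero p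
  have h2 : ∀ i, DifferentiableAt ℝ (b i) p := fun i => (h.contDiff_b i).differentiable one_ne_zero p
  have hE : dt (energyComp e b) p = ∑ i, 2 * (e i p * dt (e i) p + b i p * dt (b i) p) := by
    unfold energyComp
    rw [dt_sum (fun i _ => ((h1 i).fun_mul (h1 i)).fun_add ((h2 i).fun_mul (h2 i)))]
    refine Finset.sum_congr rfl fun i _ => ?_
    rw [dt_add ((h1 i).fun_mul (h1 i)) ((h2 i).fun_mul (h2 i)), dt_mul (h1 i) (h1 i),
      dt_mul (h2 i) (h2 i)]
    ring
  have hS : ∀ j, dx j (poyntingComp e b j) p =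
      (e (j + 1) p * dx j (b (j + 2)) p + dx j (e (j + 1)) p * b (j + 2) p) -
      (e (j + 2) p * dx j (b (j + 1)) p + dx j (e (j + 2)) p * b (j + 1) p) := fun j => by
    unfold poyntingComp
    rw [dx_sub j ((h1 _).fun_mul (h2 _)) ((h1 _).fun_mul (h2 _)), dx_mul j (h1 _) (h2 _),
      dx_mul j (h1 _) (h2 _)]
  simp only [hE, hS, h.ampere, h.faraday, Fin.sum_univ_three]
  simp only [Fin.isValue, Fin.reduceAdd]
  ring

/-- When the derivatives fall on the fields, Poynting's theorem makes the terms cancel. When they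
fall on the weight, they leave a nonpositive multiple of the energy plus flux through a normal of
length at most one. The sign `σ` treats past and future together. -/
theorem IsEvolution.weighted_energy_le (h : IsEvolution e b) (R : ℝ) {σ : ℝ} (hσ : σ ^ 2 = 1)
    (p : ℝ × Vec3) :
    σ * dt (fun p => coneWeight R σ p * energyComp e b p) p +
      ∑ j, 2 * σ * dx j (fun p => coneWeight R σ p * poyntingComp e b j p) p ≤ 0 := by
  have hψ : DifferentiableAt ℝ (coneWeight R σ) p :=
    (contDiff_coneWeight R σ).differentiable one_ne_zero p
  have hw := h.contDiff_energyComp.differentiable one_ne_zero p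
  have hS := fun j => (h.contDiff_poyntingComp j).differentiable one_ne_zero p
  rw [dt_mul hψ hw, h.dt_energyComp]
  simp_rw [fun j => dx_mul j hψ (hS j)]
  have e1 : dt (coneWeight R σ) p =
      -deriv expNegInvGlue (R - σ * p.1 - smoothNorm p.2) * σ := by
    rw [dt, fderiv_coneWeight]; simp
  have e2 : ∀ j, dx j (coneWeight R σ) p =
      -deriv expNegInvGlue (R - σ * p.1 - smoothNorm p.2) * spd j smoothNorm p.2 := fun j => by
    rw [dx, fderiv_coneWeight, spd]; simp
  simp_rw [e1, e2]
  have hd : 0 ≤ deriv expNegInvGlue (R - σ * p.1 - smoothNorm p.2) :=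
    expNegInvGlue.monotone.deriv_nonneg
  have hn : ∑ j, (σ * spd j smoothNorm p.2) ^ 2 ≤ 1 := by
    simp_rw [mul_pow, hσ, one_mul]
    exact sum_sq_spd_smoothNorm_le p.2
  have key := mul_nonneg hd
    (energy_add_flux_nonneg (fun i => e i p) (fun i => b i p) (fun j => σ * spd j smoothNorm p.2) hn)
  change 0 ≤ _ * (energyComp e b p +
    2 * ∑ j, σ * spd j smoothNorm p.2 * poyntingComp e b j p) at key
  simp only [Fin.sum_univ_three] at key ⊢
  linear_combination key -
    deriv expNegInvGlue (R - σ * p.1 - smoothNorm p.2) * energyComp e b p * hσ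

theorem integral_dx_eq_zero {g : ℝ × Vec3 → ℝ} (hg : ContDiff ℝ 1 g) {R t : ℝ}
    (hs : ∀ x ∉ Metric.closedBall (0 : Vec3) R, g (t, x) = 0) (j : Fin 3) :
    ∫ x in Metric.closedBall (0 : Vec3) R, dx j g (t, x) = 0 := by
  have hl : ContDiff ℝ 1 fun x : Vec3 => g (t, x) := by fun_prop
  have hc : HasCompactSupport fun x : Vec3 => g (t, x) :=
    HasCompactSupport.intro (isCompact_closedBall 0 R) hs
  have e1 : ∀ x, dx j g (t, x) = fderiv ℝ (fun x : Vec3 => g (t, x)) x (Pi.single j 1) := by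
    intro x
    have h1 : HasFDerivAt g (fderiv ℝ g (t, x)) (t, x) :=
      (hg.differentiable one_ne_zero _).hasFDerivAt
    have h2 := h1.comp x (hasFDerivAt_prodMk_right (𝕜 := ℝ) t x)
    exact (congrFun (congrArg DFunLike.coe h2.fderiv) _).symm
  have hd : Continuous fun x : Vec3 => fderiv ℝ (fun x : Vec3 => g (t, x)) x (Pi.single j 1) :=
    (hl.continuous_fderiv one_ne_zero).clm_apply continuous_const
  have hcd : HasCompactSupport fun x : Vec3 =>
      fderiv ℝ (fun x : Vec3 => g (t, x)) x (Pi.single j 1) := hc.fderiv_apply (𝕜 := ℝ) _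
  simp_rw [e1]
  rw [setIntegral_eq_integral_of_forall_compl_eq_zero]
  · have := integral_mul_fderiv_eq_neg_fderiv_mul_of_integrable (μ := (volume : Measure Vec3))
      (f := fun _ => (1 : ℝ)) (g := fun x : Vec3 => g (t, x)) (v := Pi.single j 1)
      (by simp) (by simpa using hd.integrable_of_hasCompactSupport hcd)
      (by simpa using hl.continuous.integrable_of_hasCompactSupport hc)
      (fun x _ => by fun_prop) (fun x _ => hl.differentiable one_ne_zero x)
    simpa using this
  · intro x hx
    have hz : (fun x : Vec3 => g (t, x)) =ᶠ[𝓝 x] fun _ => 0 := by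
      filter_upwards [Metric.isClosed_closedBall.isOpen_compl.mem_nhds hx] with y hy
      exact hs y hy
    rw [hz.fderiv_eq]
    simp

/-- Domain of dependence: the energy weighted by `coneWeight` is nonnegative, is zero at time `0`,
and cannot grow as time moves from `0` to `T`. -/
theorem IsEvolution.eq_zero (h : IsEvolution e b) (he : ∀ i x, e i (0, x) = 0)
    (hb : ∀ i x, b i (0, x) = 0) (i : Fin 3) (p : ℝ × Vec3) : e i p = 0 ∧ b i p = 0 := by
  obtain ⟨T, x₀⟩ := p
  obtain ⟨σ, hσ, hT⟩ : ∃ σ : ℝ, σ ^ 2 = 1 ∧ 0 ≤ σ * T := by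
    rcases le_total 0 T with hT | hT
    · exact ⟨1, by norm_num, by simpa using hT⟩
    · exact ⟨-1, by norm_num, by simpa using hT⟩
  -- With this radius the argument of `expNegInvGlue` in the weight equals `1` at `(T, x₀)`, so the
  -- weight is positive there.
  set R : ℝ := σ * T + smoothNorm x₀ + 1 with hR
  set K := Metric.closedBall (0 : Vec3) R with hK
  set g : ℝ × Vec3 → ℝ := fun p => coneWeight R σ p * energyComp e b p with hgdef
  have hg : ContDiff ℝ 1 g := (contDiff_coneWeight R σ).mul h.contDiff_energyComp
  have hg0 : ∀ p, 0 ≤ g p := fun p => mul_nonneg (expNegInvGlue.nonneg _)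
    (Finset.sum_nonneg fun i _ => add_nonneg (mul_self_nonneg _) (mul_self_nonneg _))
  set I : ℝ → ℝ := fun t => ∫ x in K, g (t, x) with hI
  have hI' : ∀ t, HasDerivAt I (∫ x in K, dt g (t, x)) t := by
    intro t
    have h1 := (hg.hasFDerivAt_setIntegral (μ := (volume : Measure Vec3))
      (isCompact_closedBall (0 : Vec3) R) t).hasDerivAt
    rw [ContinuousLinearMap.integral_apply] at h1
    · exact h1
    · exact ((((hg.continuous_fderiv one_ne_zero).comp (by fun_prop :
        Continuous fun x : Vec3 => (t, x))).clm_comp continuous_const).continuousOn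
        ).integrableOn_compact (isCompact_closedBall _ _)
  have hσσ : ∀ s, σ * (σ * s) = s := fun s => by rw [← mul_assoc, ← sq, hσ, one_mul]
  -- The time `σ s` runs from `0` to `T` as `s` runs from `0` to `σ T ≥ 0`, whichever sign `T` has.
  have hJ : AntitoneOn (fun s => I (σ * s)) (Ici 0) := by
    have hJ' : ∀ s, HasDerivAt (fun s => I (σ * s)) ((∫ x in K, dt g (σ * s, x)) * σ) s := by
      intro s
      simpa [Function.comp_def] using (hI' (σ * s)).comp s ((hasDerivAt_id s).const_mul σ)
    refine antitoneOn_of_deriv_nonpos (convex_Ici 0)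
      (fun s _ => (hJ' s).continuousAt.continuousWithinAt)
      (fun s _ => (hJ' s).differentiableAt.differentiableWithinAt) fun s hs => ?_
    rw [interior_Ici] at hs
    rw [(hJ' s).deriv]
    have hP : ∀ j, ContDiff ℝ 1 fun p => coneWeight R σ p * poyntingComp e b j p := fun j =>
      (contDiff_coneWeight R σ).mul (h.contDiff_poyntingComp j)
    have hz : ∀ j, ∫ x in K, dx j (fun p => coneWeight R σ p * poyntingComp e b j p) (σ * s, x)
        = 0 := fun j => integral_dx_eq_zero (hP j) (fun x hx => by
      rw [coneWeight_eq_zero (by simp only [hσσ]; exact (mem_Ioi.1 hs).le) hx, zero_mul]) j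
    have hi1 : IntegrableOn (fun x => dt g (σ * s, x)) K :=
      ((continuous_dt hg).comp (by fun_prop : Continuous fun x : Vec3 => (σ * s, x))
        ).continuousOn.integrableOn_compact (isCompact_closedBall _ _)
    have hi2 : ∀ j, IntegrableOn
        (fun x => dx j (fun p => coneWeight R σ p * poyntingComp e b j p) (σ * s, x)) K := fun j =>
      ((continuous_dx j (hP j)).comp (by fun_prop : Continuous fun x : Vec3 => (σ * s, x))
        ).continuousOn.integrableOn_compact (isCompact_closedBall _ _)
    have e1 : (∫ x in K, dt g (σ * s, x)) * σ = ∫ x in K, (σ * dt g (σ * s, x) +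
        ∑ j, 2 * σ * dx j (fun p => coneWeight R σ p * poyntingComp e b j p) (σ * s, x)) := by
      rw [integral_add (hi1.const_mul σ)
        (integrable_finsetSum _ fun j _ => (hi2 j).const_mul (2 * σ)),
        integral_finsetSum _ fun j _ => (hi2 j).const_mul (2 * σ)]
      simp_rw [integral_const_mul, hz]
      simp [mul_comm]
    rw [e1]
    exact integral_nonpos fun x => h.weighted_energy_le R hσ (σ * s, x)
  have hI0 : I 0 = 0 := by
    have : ∀ x, g (0, x) = 0 := fun x => by simp [hgdef, energyComp, he, hb]
    simp [hI, this]
  have hIT : I T ≤ 0 := by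
    have := hJ (mem_Ici.2 le_rfl) (mem_Ici.2 hT) hT
    simpa [hσσ, hI0] using this
  have hsupp : ∀ x ∉ K, g (T, x) = 0 := fun x hx => by
    simp only [hgdef]
    rw [coneWeight_eq_zero hT hx, zero_mul]
  have hgT : g (T, x₀) = 0 := by
    by_contra hne
    have hc : HasCompactSupport fun x : Vec3 => g (T, x) :=
      HasCompactSupport.intro (isCompact_closedBall 0 R) hsupp
    have hpos := Continuous.integral_pos_of_hasCompactSupport_nonneg_nonzero
      (μ := (volume : Measure Vec3))
      (hg.continuous.comp (by fun_prop : Continuous fun x : Vec3 => (T, x))) hc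
      (fun x => hg0 _) hne
    have e2 : I T = ∫ x, g (T, x) := setIntegral_eq_integral_of_forall_compl_eq_zero hsupp
    simp only [Function.comp_def] at hpos
    linarith
  have hw : energyComp e b (T, x₀) = 0 := by
    refine (mul_eq_zero.1 hgT).resolve_left (expNegInvGlue.pos_of_pos ?_).ne'
    simp only [hR]
    linarith
  have hterm := (Finset.sum_eq_zero_iff_of_nonneg fun i _ =>
    add_nonneg (mul_self_nonneg (e i (T, x₀))) (mul_self_nonneg (b i (T, x₀)))).1 hw i
    (Finset.mem_univ i)
  have := (add_eq_zero_iff_of_nonneg (mul_self_nonneg _) (mul_self_nonneg _)).1 hterm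
  exact ⟨mul_self_eq_zero.1 this.1, mul_self_eq_zero.1 this.2⟩

end Energy

/-! ### Commuting second derivatives. -/

section SecondDerivatives

variable {A : Type*} [NormedAddCommGroup A] [NormedSpace ℝ A] {g : ℝ × Vec3 → A}

@[fun_prop]
theorem contDiff_dt (hg : ContDiff ℝ ω g) : ContDiff ℝ ω (dt g) := by
  unfold dt
  fun_prop

@[fun_prop]
theorem contDiff_dx (hg : ContDiff ℝ ω g) (j : Fin 3) : ContDiff ℝ ω (dx j g) := by
  unfold dx
  fun_prop

theorem fderiv_fderiv_apply_comm (hg : ContDiff ℝ ω g) (v w p : ℝ × Vec3) :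
    fderiv ℝ (fun p => fderiv ℝ g p v) p w = fderiv ℝ (fun p => fderiv ℝ g p w) p v := by
  have h : ∀ v w, fderiv ℝ (fun p => fderiv ℝ g p v) p w = fderiv ℝ (fderiv ℝ g) p w v := by
    intro v w
    have hd : DifferentiableAt ℝ (fderiv ℝ g) p :=
      (hg.fderiv_right (m := ω) (by simp)).differentiable (by simp) p
    rw [fderiv_clm_apply hd (by fun_prop)]
    simp
  rw [h, h]
  exact (hg.contDiffAt.isSymmSndFDerivAt (by simp)).eq _ _

theorem dt_dx_comm (hg : ContDiff ℝ ω g) (j : Fin 3) : dt (dx j g) = dx j (dt g) :=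
  funext fun p => fderiv_fderiv_apply_comm hg _ _ p

theorem dx_dx_comm (hg : ContDiff ℝ ω g) (j k : Fin 3) : dx j (dx k g) = dx k (dx j g) :=
  funext fun p => fderiv_fderiv_apply_comm hg _ _ p

end SecondDerivatives

theorem IsEvolution.sub {e b e' b' : Fin 3 → ℝ × Vec3 → ℝ} (h : IsEvolution e b)
    (h' : IsEvolution e' b') :
    IsEvolution (fun i p => e i p - e' i p) (fun i p => b i p - b' i p) := by
  have h1 : ∀ i p, DifferentiableAt ℝ (e i) p := fun i => (h.contDiff_e i).differentiable one_ne_zero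
  have h2 : ∀ i p, DifferentiableAt ℝ (b i) p := fun i => (h.contDiff_b i).differentiable one_ne_zero
  have h3 : ∀ i p, DifferentiableAt ℝ (e' i) p := fun i =>
    (h'.contDiff_e i).differentiable one_ne_zero
  have h4 : ∀ i p, DifferentiableAt ℝ (b' i) p := fun i =>
    (h'.contDiff_b i).differentiable one_ne_zero
  refine ⟨fun i => (h.contDiff_e i).sub (h'.contDiff_e i),
    fun i => (h.contDiff_b i).sub (h'.contDiff_b i), fun i p => ?_, fun i p => ?_⟩
  · rw [dt_sub (h1 _ _) (h3 _ _), dx_sub _ (h2 _ _) (h4 _ _), dx_sub _ (h2 _ _) (h4 _ _),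
      h.ampere, h'.ampere]
    ring
  · rw [dt_sub (h2 _ _) (h4 _ _), dx_sub _ (h1 _ _) (h3 _ _), dx_sub _ (h1 _ _) (h3 _ _),
      h.faraday, h'.faraday]
    ring

/-! ### An analytic Maxwell solution from analytic data. -/

section Existence

variable {f g : Fin 3 → Vec3 → ℝ}

/-- The electric field generated by the initial data `f` (electric) and `g` (magnetic). -/
def kirchhoffField (f g : Fin 3 → Vec3 → ℝ) (i : Fin 3) (p : ℝ × Vec3) : ℝ :=
  dt (kirchhoff (f i)) p +
    (dx (i + 1) (kirchhoff (g (i + 2))) p - dx (i + 2) (kirchhoff (g (i + 1))) p)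

theorem contDiff_kirchhoffField (hf : ∀ i, ContDiff ℝ ω (f i)) (hg : ∀ i, ContDiff ℝ ω (g i))
    (i : Fin 3) : ContDiff ℝ ω (kirchhoffField f g i) := by
  have h1 := fun i => contDiff_kirchhoff (hf i)
  have h2 := fun i => contDiff_kirchhoff (hg i)
  unfold kirchhoffField
  exact (contDiff_dt (h1 _)).add ((contDiff_dx (h2 _) _).sub (contDiff_dx (h2 _) _))

theorem kirchhoffField_zero_time (hf : ∀ i, ContDiff ℝ ω (f i)) (hg : ∀ i, ContDiff ℝ ω (g i))
    (i : Fin 3) (x : Vec3) : kirchhoffField f g i (0, x) = f i x := by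
  unfold kirchhoffField
  simp only [dt_kirchhoff_zero_time (hf _), dx_kirchhoff (hg _), kirchhoff_zero_time]
  ring

theorem div_kirchhoff (hf : ∀ i, ContDiff ℝ ω (f i)) (hdiv : ∀ x, ∑ i, spd i (f i) x = 0)
    (p : ℝ × Vec3) : ∑ i, dx i (kirchhoff (f i)) p = 0 := by
  have h := fun i => contDiff_spd (hf i) i
  have hz : (fun x => spd 0 (f 0) x + spd 1 (f 1) x + spd 2 (f 2) x) = fun _ => 0 := by
    funext x
    have := hdiv x
    rwa [Fin.sum_univ_three] at this
  simp only [dx_kirchhoff (hf _), Fin.sum_univ_three]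
  rw [← kirchhoff_add (h 0) (h 1), ← kirchhoff_add (by fun_prop) (h 2), hz, kirchhoff_zero]

theorem dx_div_kirchhoff (hf : ∀ i, ContDiff ℝ ω (f i)) (hdiv : ∀ x, ∑ i, spd i (f i) x = 0)
    (j : Fin 3) (p : ℝ × Vec3) : ∑ i, dx j (dx i (kirchhoff (f i))) p = 0 := by
  rw [← dx_sum j fun i _ =>
    (contDiff_dx (contDiff_kirchhoff (hf i)) i).differentiable (by simp) p]
  simp only [div_kirchhoff hf hdiv]
  simp [dx]

theorem dt_kirchhoffField (hf : ∀ i, ContDiff ℝ ω (f i)) (hg : ∀ i, ContDiff ℝ ω (g i))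
    (i : Fin 3) (p : ℝ × Vec3) :
    dt (kirchhoffField f g i) p = ∑ j, dx j (dx j (kirchhoff (f i))) p +
      (dx (i + 1) (dt (kirchhoff (g (i + 2)))) p - dx (i + 2) (dt (kirchhoff (g (i + 1)))) p) := by
  have h1 := fun i => contDiff_kirchhoff (hf i)
  have h2 := fun i => contDiff_kirchhoff (hg i)
  have d1 : ∀ i, DifferentiableAt ℝ (dt (kirchhoff (f i))) p := fun i =>
    (contDiff_dt (h1 i)).differentiable (by simp) p
  have d2 : ∀ j i, DifferentiableAt ℝ (dx j (kirchhoff (g i))) p := fun j i =>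
    (contDiff_dx (h2 i) j).differentiable (by simp) p
  unfold kirchhoffField
  rw [dt_add (d1 _) ((d2 _ _).fun_sub (d2 _ _)), dt_sub (d2 _ _) (d2 _ _), wave_kirchhoff (hf i),
    dt_dx_comm (h2 _), dt_dx_comm (h2 _)]

theorem dx_kirchhoffField (hf : ∀ i, ContDiff ℝ ω (f i)) (hg : ∀ i, ContDiff ℝ ω (g i))
    (i j : Fin 3) (p : ℝ × Vec3) :
    dx j (kirchhoffField f g i) p = dx j (dt (kirchhoff (f i))) p +
      (dx j (dx (i + 1) (kirchhoff (g (i + 2)))) p -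
        dx j (dx (i + 2) (kirchhoff (g (i + 1)))) p) := by
  have h1 := fun i => contDiff_kirchhoff (hf i)
  have h2 := fun i => contDiff_kirchhoff (hg i)
  have d1 : ∀ i, DifferentiableAt ℝ (dt (kirchhoff (f i))) p := fun i =>
    (contDiff_dt (h1 i)).differentiable (by simp) p
  have d2 : ∀ j i, DifferentiableAt ℝ (dx j (kirchhoff (g i))) p := fun j i =>
    (contDiff_dx (h2 i) j).differentiable (by simp) p
  unfold kirchhoffField
  rw [dx_add j (d1 _) ((d2 _ _).fun_sub (d2 _ _)), dx_sub j (d2 _ _) (d2 _ _)]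

theorem kirchhoff_neg (f : Vec3 → ℝ) : kirchhoff (fun x => -f x) = fun p => -kirchhoff f p := by
  funext p
  simp [kirchhoff, sphereIntegral]

theorem dx_neg {A : Type*} [NormedAddCommGroup A] [NormedSpace ℝ A] (j : Fin 3)
    (g : ℝ × Vec3 → A) : dx j (fun p => -g p) = fun p => -dx j g p := by
  funext p
  simp only [dx, fderiv_fun_neg]
  rfl

theorem dt_neg {A : Type*} [NormedAddCommGroup A] [NormedSpace ℝ A] (g : ℝ × Vec3 → A) :
    dt (fun p => -g p) = fun p => -dt g p := by
  funext p
  simp only [dt, fderiv_fun_neg]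
  rfl

theorem kirchhoffField_neg (f g : Fin 3 → Vec3 → ℝ) (i : Fin 3) :
    kirchhoffField (fun i x => -f i x) (fun i x => -g i x) i =
      fun p => -kirchhoffField f g i p := by
  funext p
  simp only [kirchhoffField, kirchhoff_neg, dx_neg, dt_neg]
  ring

/-- Writing `K` for `kirchhoff`, the fields are `e = ∂ₜKf + curl Kg` and `b = ∂ₜKg - curl Kf`. Since
`Kf` is divergence-free and solves the wave equation, `∂ₜ²Kf = ΔKf = -curl curl Kf`, which is the
missing part of `curl b`. -/
theorem dt_kirchhoffField_eq_curl (hf : ∀ i, ContDiff ℝ ω (f i)) (hg : ∀ i, ContDiff ℝ ω (g i))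
    (hdiv : ∀ x, ∑ i, spd i (f i) x = 0) (i : Fin 3) (p : ℝ × Vec3) :
    dt (kirchhoffField f g i) p =
      dx (i + 1) (kirchhoffField g (fun i x => -f i x) (i + 2)) p -
      dx (i + 2) (kirchhoffField g (fun i x => -f i x) (i + 1)) p := by
  have hf' : ∀ i, ContDiff ℝ ω (fun x => -f i x) := fun i => (hf i).neg
  have hneg : ∀ j k i, dx j (dx k (kirchhoff fun x => -f i x)) p =
      -dx j (dx k (kirchhoff (f i))) p := fun j k i => by
    rw [kirchhoff_neg, dx_neg, dx_neg]
  rw [dt_kirchhoffField hf hg, dx_kirchhoffField hg hf', dx_kirchhoffField hg hf']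
  have hd := dx_div_kirchhoff hf hdiv i p
  have hk := fun i => contDiff_kirchhoff (hf i)
  simp only [hneg, Fin.sum_univ_three] at hd ⊢
  fin_cases i
  · simp only [Fin.zero_eta, Fin.isValue, Fin.reduceAdd] at hd ⊢
    rw [dx_dx_comm (hk 1) 1 0, dx_dx_comm (hk 2) 2 0]
    linear_combination hd
  · simp only [Fin.mk_one, Fin.isValue, Fin.reduceAdd] at hd ⊢
    rw [dx_dx_comm (hk 0) 0 1, dx_dx_comm (hk 2) 2 1]
    linear_combination hd
  · simp only [Fin.reduceFinMk, Fin.isValue, Fin.reduceAdd] at hd ⊢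
    rw [dx_dx_comm (hk 0) 0 2, dx_dx_comm (hk 1) 1 2]
    linear_combination hd

/-- Faraday's law is Ampère's law for the dual data `(g, -f)`. -/
theorem isEvolution_kirchhoffField (hf : ∀ i, ContDiff ℝ ω (f i)) (hg : ∀ i, ContDiff ℝ ω (g i))
    (hdivf : ∀ x, ∑ i, spd i (f i) x = 0) (hdivg : ∀ x, ∑ i, spd i (g i) x = 0) :
    IsEvolution (kirchhoffField f g) (kirchhoffField g fun i x => -f i x) := by
  have hf' : ∀ i, ContDiff ℝ ω (fun x => -f i x) := fun i => (hf i).neg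
  refine ⟨fun i => (contDiff_kirchhoffField hf hg i).of_le (by simp),
    fun i => (contDiff_kirchhoffField hg hf' i).of_le (by simp),
    dt_kirchhoffField_eq_curl hf hg hdivf, fun i p => ?_⟩
  rw [dt_kirchhoffField_eq_curl hg hf' hdivg, kirchhoffField_neg, kirchhoffField_neg, dx_neg,
    dx_neg]
  ring

/-- A `C¹` solution of Maxwell's equations with analytic initial data is analytic. -/
theorem IsEvolution.contDiff_omega {e b : Fin 3 → ℝ × Vec3 → ℝ} (h : IsEvolution e b)
    (hf : ∀ i, ContDiff ℝ ω (f i)) (hg : ∀ i, ContDiff ℝ ω (g i))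
    (he : ∀ i x, e i (0, x) = f i x) (hb : ∀ i x, b i (0, x) = g i x)
    (hdivf : ∀ x, ∑ i, spd i (f i) x = 0) (hdivg : ∀ x, ∑ i, spd i (g i) x = 0) (i : Fin 3) :
    ContDiff ℝ ω (e i) ∧ ContDiff ℝ ω (b i) := by
  have hf' : ∀ i, ContDiff ℝ ω (fun x => -f i x) := fun i => (hf i).neg
  -- The difference from the Kirchhoff solution has zero initial data, so uniqueness makes the given
  -- solution equal to an analytic one.
  have key := (h.sub (isEvolution_kirchhoffField hf hg hdivf hdivg)).eq_zero
    (fun i x => by rw [he, kirchhoffField_zero_time hf hg, sub_self])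
    (fun i x => by rw [hb, kirchhoffField_zero_time hg hf', sub_self]) i
  have e1 : e i = kirchhoffField f g i := funext fun p => sub_eq_zero.1 (key p).1
  have e2 : b i = kirchhoffField g (fun i x => -f i x) i := funext fun p => sub_eq_zero.1 (key p).2
  rw [e1, e2]
  exact ⟨contDiff_kirchhoffField hf hg i, contDiff_kirchhoffField hg hf' i⟩

end Existence

/-! ### Vanishing of time derivatives and unique continuation. -/

section VanishingOrder

/-- `g` and its first `k - 1` time derivatives vanish on `{0} × U`. -/
def VanishesToOrder (U : Set Vec3) : ℕ → (ℝ × Vec3 → ℂ) → Prop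
  | 0, _ => True
  | k + 1, g => (∀ x ∈ U, g (0, x) = 0) ∧ VanishesToOrder U k (dt g)

namespace VanishesToOrder

variable {U : Set Vec3} {g h a : ℝ × Vec3 → ℂ} {k : ℕ}

theorem of_succ : ∀ {k : ℕ} {g : ℝ × Vec3 → ℂ}, VanishesToOrder U (k + 1) g → VanishesToOrder U k g
  | 0, _, _ => trivial
  | _ + 1, _, hg => ⟨hg.1, of_succ hg.2⟩

theorem add (hg : ContDiff ℝ ω g) (hh : ContDiff ℝ ω h) (vg : VanishesToOrder U k g)
    (vh : VanishesToOrder U k h) : VanishesToOrder U k fun p => g p + h p := by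
  induction k generalizing g h with
  | zero => trivial
  | succ k ih =>
    refine ⟨fun x hx => by simp only [vg.1 x hx, vh.1 x hx, add_zero], ?_⟩
    have e : dt (fun p => g p + h p) = fun p => dt g p + dt h p := funext fun p =>
      dt_add (hg.differentiable (by simp) p) (hh.differentiable (by simp) p)
    rw [e]
    exact ih (contDiff_dt hg) (contDiff_dt hh) vg.2 vh.2

theorem mul (ha : ContDiff ℝ ω a) (hg : ContDiff ℝ ω g) (vg : VanishesToOrder U k g) :
    VanishesToOrder U k fun p => a p * g p := by
  induction k generalizing a g with
  | zero => trivial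
  | succ k ih =>
    refine ⟨fun x hx => by simp only [vg.1 x hx, mul_zero], ?_⟩
    have e : dt (fun p => a p * g p) = fun p => a p * dt g p + dt a p * g p := funext fun p =>
      dt_mul (ha.differentiable (by simp) p) (hg.differentiable (by simp) p)
    rw [e]
    exact add (ha.mul (contDiff_dt hg)) ((contDiff_dt ha).mul hg) (ih ha (contDiff_dt hg) vg.2)
      (ih (contDiff_dt ha) hg vg.of_succ)

theorem sum {ι : Type*} {s : Finset ι} {g : ι → ℝ × Vec3 → ℂ} (hg : ∀ i, ContDiff ℝ ω (g i))
    (vg : ∀ i, VanishesToOrder U k (g i)) : VanishesToOrder U k fun p => ∑ i ∈ s, g i p := by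
  classical
  induction s using Finset.induction_on with
  | empty =>
    simp only [Finset.sum_empty]
    clear vg
    induction k with
    | zero => trivial
    | succ k ih =>
      refine ⟨fun _ _ => rfl, ?_⟩
      have : dt (fun _ : ℝ × Vec3 => (0 : ℂ)) = fun _ => 0 := funext fun p => by simp [dt]
      rwa [this]
  | insert i s hi ih =>
    simp only [Finset.sum_insert hi]
    exact add (hg i) (by fun_prop) (vg i) ih

theorem dx_apply_eq_zero (hU : IsOpen U) (hg : ContDiff ℝ ω g) (h0 : ∀ x ∈ U, g (0, x) = 0)
    (j : Fin 3) {x : Vec3} (hx : x ∈ U) : dx j g (0, x) = 0 := by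
  have h1 : HasFDerivAt g (fderiv ℝ g (0, x)) (0, x) :=
    (hg.differentiable (by simp) _).hasFDerivAt
  have h2 := h1.comp x (hasFDerivAt_prodMk_right (𝕜 := ℝ) (0 : ℝ) x)
  have h3 : (g ∘ fun y : Vec3 => ((0 : ℝ), y)) =ᶠ[𝓝 x] fun _ => 0 := by
    filter_upwards [hU.mem_nhds hx] with y hy using h0 y hy
  have h4 := congrFun (congrArg DFunLike.coe h2.fderiv) (Pi.single j 1)
  rw [h3.fderiv_eq] at h4
  simpa [dx] using h4.symm

theorem dx (hU : IsOpen U) (hg : ContDiff ℝ ω g) (vg : VanishesToOrder U k g) (j : Fin 3) :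
    VanishesToOrder U k (dx j g) := by
  induction k generalizing g with
  | zero => trivial
  | succ k ih =>
    refine ⟨fun x hx => dx_apply_eq_zero hU hg vg.1 j hx, ?_⟩
    rw [dt_dx_comm hg]
    exact ih (contDiff_dt hg) vg.2

/-- Division by `a`, one order at a time: `a ∂ₜg = ∂ₜ(a g) - (∂ₜa) g`, where the last term is
controlled by the order already obtained for `g`. -/
theorem of_mul (ha : ContDiff ℝ ω a) (hg : ContDiff ℝ ω g) (ha0 : ∀ x ∈ U, a (0, x) ≠ 0)
    (v : VanishesToOrder U k fun p => a p * g p) : VanishesToOrder U k g := by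
  induction k generalizing g with
  | zero => trivial
  | succ k ih =>
    refine ⟨fun x hx => (mul_eq_zero.1 (v.1 x hx)).resolve_left (ha0 x hx), ?_⟩
    have vg : VanishesToOrder U k g := ih hg v.of_succ
    refine ih (contDiff_dt hg) ?_
    have e : (fun p => a p * dt g p) = fun p => dt (fun p => a p * g p) p + -dt a p * g p := by
      funext p
      rw [dt_mul (ha.differentiable (by simp) p) (hg.differentiable (by simp) p)]
      ring
    rw [e]
    exact add (contDiff_dt (ha.mul hg)) ((contDiff_dt ha).neg.mul hg) v.2
      (mul (contDiff_dt ha).neg hg vg)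

theorem iterate_dt_eq_zero : ∀ {k : ℕ} {g : ℝ × Vec3 → ℂ}, VanishesToOrder U (k + 1) g →
    ∀ x ∈ U, dt^[k] g (0, x) = 0
  | 0, _, vg => vg.1
  | k + 1, g, vg => iterate_dt_eq_zero (k := k) (g := dt g) vg.2

end VanishesToOrder

theorem hasDerivAt_time {G : Type*} [NormedAddCommGroup G] [NormedSpace ℝ G] {g : ℝ × Vec3 → G}
    {t : ℝ} {x : Vec3} (hg : DifferentiableAt ℝ g (t, x)) :
    HasDerivAt (fun s => g (s, x)) (dt g (t, x)) t :=
  hg.hasFDerivAt.comp_hasDerivAt t ((hasDerivAt_id t).prodMk (hasDerivAt_const t x))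

theorem iteratedDeriv_time {g : ℝ × Vec3 → ℂ} (hg : ContDiff ℝ ω g) (x : Vec3) (n : ℕ) :
    iteratedDeriv n (fun s => g (s, x)) = fun s => dt^[n] g (s, x) := by
  induction n generalizing g with
  | zero => simp
  | succ n ih =>
    rw [iteratedDeriv_succ']
    have : deriv (fun s => g (s, x)) = fun s => dt g (s, x) := funext fun s =>
      (hasDerivAt_time (hg.differentiable (by simp) _)).deriv
    rw [this, ih (contDiff_dt hg)]
    rfl

/-- An analytic function on space-time all of whose time derivatives vanish at time `0` over a
nonempty open set vanishes identically. -/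
theorem eq_zero_of_vanishesToOrder {U : Set Vec3} (hU : IsOpen U) (hne : U.Nonempty)
    {g : ℝ × Vec3 → ℂ} (hg : ContDiff ℝ ω g) (v : ∀ k, VanishesToOrder U k g) (p : ℝ × Vec3) :
    g p = 0 := by
  have hline : ∀ x ∈ U, ∀ t, g (t, x) = 0 := by
    intro x hx t
    have ha : AnalyticOnNhd ℝ (fun s => g (s, x)) univ :=
      contDiff_omega_iff_analyticOnNhd.1 (by fun_prop)
    -- All time derivatives vanish at `0`, so the identity theorem applies along each time line over
    -- `U`; it is applied below once more in `x` at fixed `t`.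
    have htop : analyticOrderAt (fun s => g (s, x)) 0 = ⊤ := by
      refine ENat.eq_top_iff_forall_ge.2 fun n => ?_
      refine (natCast_le_analyticOrderAt_iff_iteratedDeriv_eq_zero (ha 0 (mem_univ _))).2
        fun i _ => ?_
      rw [iteratedDeriv_time hg]
      exact (v (i + 1)).iterate_dt_eq_zero x hx
    have := ha.eq_of_eventuallyEq (g := fun _ => 0) analyticOnNhd_const
      (analyticOrderAt_eq_top.1 htop)
    exact congrFun this t
  obtain ⟨t, x⟩ := p
  obtain ⟨x₀, hx₀⟩ := hne
  have ha : AnalyticOnNhd ℝ (fun y => g (t, y)) univ :=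
    contDiff_omega_iff_analyticOnNhd.1 (by fun_prop)
  have := ha.eq_of_eventuallyEq (g := fun _ => 0) (z₀ := x₀) analyticOnNhd_const (by
    filter_upwards [hU.mem_nhds hx₀] with y hy using hline y hy t)
  exact congrFun this x

/-- Uniqueness for a degenerate linear wave equation with analytic coefficients, whose leading
coefficient does not vanish over an open part of the initial surface. -/
theorem eq_zero_of_linear_wave {U : Set Vec3} (hU : IsOpen U) (hne : U.Nonempty)
    {g a ct c : ℝ × Vec3 → ℂ} {cx : Fin 3 → ℝ × Vec3 → ℂ} (hg : ContDiff ℝ ω g)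
    (ha : ContDiff ℝ ω a) (hct : ContDiff ℝ ω ct) (hc : ContDiff ℝ ω c)
    (hcx : ∀ j, ContDiff ℝ ω (cx j)) (ha0 : ∀ x ∈ U, a (0, x) ≠ 0)
    (heq : ∀ p, a p * (dt (dt g) p - ∑ j, dx j (dx j g) p) =
      ct p * dt g p + ∑ j, cx j p * dx j g p + c p * g p)
    (h0 : ∀ x ∈ U, g (0, x) = 0) (h1 : ∀ x ∈ U, dt g (0, x) = 0) (p : ℝ × Vec3) : g p = 0 := by
  refine eq_zero_of_vanishesToOrder hU hne hg (fun k => ?_) p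
  have htt := contDiff_dt (contDiff_dt hg)
  have hxx := fun j => contDiff_dx (contDiff_dx hg j) j
  suffices H : ∀ k, VanishesToOrder U (k + 1) g from (H k).of_succ
  intro k
  induction k with
  | zero => exact ⟨h0, trivial⟩
  | succ k ih =>
    refine ⟨h0, h1, ?_⟩
    -- The equation writes `a ∂ₜ²g` through terms with at most one time derivative of `g`. These
    -- vanish to order `k` because `g` vanishes to order `k + 1`, and spatial derivatives cost no
    -- order as `U` is open.
    refine VanishesToOrder.of_mul ha htt ha0 ?_
    have e : (fun p => a p * dt (dt g) p) = fun p => (∑ j, a p * dx j (dx j g) p) +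
        (ct p * dt g p + (∑ j, cx j p * dx j g p + c p * g p)) := by
      funext p
      rw [← Finset.mul_sum]
      linear_combination heq p
    rw [e]
    have hdt := contDiff_dt hg
    have hdx := contDiff_dx hg
    have vg := ih.of_succ
    refine VanishesToOrder.add (by fun_prop) (by fun_prop)
      (VanishesToOrder.sum (fun j => by fun_prop) fun j =>
        VanishesToOrder.mul ha (hxx j) ((vg.dx hU hg j).dx hU (hdx j) j)) ?_
    refine VanishesToOrder.add (by fun_prop) (by fun_prop) (VanishesToOrder.mul hct hdt ih.2) ?_
    exact VanishesToOrder.add (by fun_prop) (by fun_prop)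
      (VanishesToOrder.sum (fun j => by fun_prop) fun j =>
        VanishesToOrder.mul (hcx j) (hdx j) (vg.dx hU hg j))
      (VanishesToOrder.mul hc hg vg)

end VanishingOrder

/-! ### The wave equation satisfied by the null invariant. -/

section NullWave

open Complex

/-- The letters `t, x, y, z` are first derivatives of `φ₀, φ₁, φ₂`, with `y` and `z` rescaled by `s
I` and `s`, which flips the sign of the `y` squares. The left side is `φ₀² □N` for `N = φ₁² - φ₀φ₂`,
once second derivatives have cancelled by the wave equation. Each factor such as `2 φ₁ t₁ - φ₀ t₂ -
φ₂ t₀` is a first derivative of `N`. The four Maxwell relations eliminate `t₀, t₁, t₂, x₂`, leaving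
a polynomial identity. -/
theorem null_wave_identity_aux (φ₀ φ₁ φ₂ t₀ t₁ t₂ x₀ x₁ x₂ y₀ y₁ y₂ z₀ z₁ z₂ : ℂ)
    (h₁ : t₀ + z₀ = x₁ - y₁) (h₂ : t₁ + z₁ = x₂ - y₂)
    (h₃ : t₁ - z₁ = x₀ + y₀) (h₄ : t₂ - z₂ = x₁ + y₁) :
    φ₀ ^ 2 * (2 * (t₁ ^ 2 - x₁ ^ 2 + y₁ ^ 2 - z₁ ^ 2)
        - 2 * (t₀ * t₂ - x₀ * x₂ + y₀ * y₂ - z₀ * z₂)) =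
      (3 * φ₀ * (t₀ + z₀) + φ₀ * (t₀ - z₀) - 2 * φ₁ * (x₀ - y₀)) *
        (2 * φ₁ * t₁ - φ₀ * t₂ - φ₂ * t₀) +
      (-3 * φ₀ * (x₀ + y₀) - φ₀ * (x₀ - y₀) + 2 * φ₁ * (t₀ - z₀)) *
        (2 * φ₁ * x₁ - φ₀ * x₂ - φ₂ * x₀) +
      (3 * φ₀ * (x₀ + y₀) - φ₀ * (x₀ - y₀) - 2 * φ₁ * (t₀ - z₀)) *
        (2 * φ₁ * y₁ - φ₀ * y₂ - φ₂ * y₀) +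
      (-3 * φ₀ * (t₀ + z₀) + φ₀ * (t₀ - z₀) + 2 * φ₁ * (x₀ - y₀)) *
        (2 * φ₁ * z₁ - φ₀ * z₂ - φ₂ * z₀) +
      -4 * ((t₀ - z₀) * (t₀ + z₀) - (x₀ - y₀) * (x₀ + y₀)) * (φ₁ ^ 2 - φ₀ * φ₂) := by
  obtain rfl : t₀ = x₁ - y₁ - z₀ := by linear_combination h₁
  obtain rfl : t₁ = x₀ + y₀ + z₁ := by linear_combination h₃
  obtain rfl : t₂ = x₁ + y₁ + z₂ := by linear_combination h₄
  obtain rfl : x₂ = x₀ + y₀ + z₁ + z₁ + y₂ := by linear_combination -h₂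
  ring

theorem null_wave_identity (s φ₀ φ₁ φ₂ t₀ t₁ t₂ x₀ x₁ x₂ y₀ y₁ y₂ z₀ z₁ z₂ : ℂ) (hs : s ^ 2 = 1)
    (h₁ : t₀ + s * z₀ = x₁ - s * I * y₁) (h₂ : t₁ + s * z₁ = x₂ - s * I * y₂)
    (h₃ : t₁ - s * z₁ = x₀ + s * I * y₀) (h₄ : t₂ - s * z₂ = x₁ + s * I * y₁) :
    φ₀ ^ 2 * (2 * (t₁ ^ 2 - x₁ ^ 2 - y₁ ^ 2 - z₁ ^ 2)
        - 2 * (t₀ * t₂ - x₀ * x₂ - y₀ * y₂ - z₀ * z₂)) =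
      (3 * φ₀ * (t₀ + s * z₀) + φ₀ * (t₀ - s * z₀) - 2 * φ₁ * (x₀ - s * I * y₀)) *
        (2 * φ₁ * t₁ - φ₀ * t₂ - φ₂ * t₀) +
      (-3 * φ₀ * (x₀ + s * I * y₀) - φ₀ * (x₀ - s * I * y₀) + 2 * φ₁ * (t₀ - s * z₀)) *
        (2 * φ₁ * x₁ - φ₀ * x₂ - φ₂ * x₀) +
      s * I * (3 * φ₀ * (x₀ + s * I * y₀) - φ₀ * (x₀ - s * I * y₀) - 2 * φ₁ * (t₀ - s * z₀)) *
        (2 * φ₁ * y₁ - φ₀ * y₂ - φ₂ * y₀) +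
      s * (-3 * φ₀ * (t₀ + s * z₀) + φ₀ * (t₀ - s * z₀) + 2 * φ₁ * (x₀ - s * I * y₀)) *
        (2 * φ₁ * z₁ - φ₀ * z₂ - φ₂ * z₀) +
      -4 * ((t₀ - s * z₀) * (t₀ + s * z₀) - (x₀ - s * I * y₀) * (x₀ + s * I * y₀)) *
        (φ₁ ^ 2 - φ₀ * φ₂) := by
  have hsI : s ^ 2 * I ^ 2 + 1 = 0 := by rw [hs, I_sq]; ring
  have key := null_wave_identity_aux φ₀ φ₁ φ₂ t₀ t₁ t₂ x₀ x₁ x₂ (s * I * y₀) (s * I * y₁)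
    (s * I * y₂) (s * z₀) (s * z₁) (s * z₂) h₁ h₂ h₃ h₄
  linear_combination key + φ₀ ^ 2 * (2 * y₀ * y₂ - 2 * y₁ ^ 2) * hsI +
    φ₀ ^ 2 * (2 * z₁ ^ 2 - 2 * z₀ * z₂) * hs

/-- If the spinor components `φ₀`, `φ₁`, `φ₂` of an analytic Maxwell field satisfy
`φ₁² = φ₀ φ₂` to first order on the initial surface and `φ₀` is somewhere nonzero there, then the
field is null everywhere. -/
theorem null_of_spinor_components {s : ℂ} (hs : s ^ 2 = 1) {φ₀ φ₁ φ₂ : ℝ × Vec3 → ℂ}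
    (c₀ : ContDiff ℝ ω φ₀) (c₁ : ContDiff ℝ ω φ₁) (c₂ : ContDiff ℝ ω φ₂)
    (h₁ : ∀ p, dt φ₀ p + s * dx 2 φ₀ p = dx 0 φ₁ p - s * I * dx 1 φ₁ p)
    (h₂ : ∀ p, dt φ₁ p + s * dx 2 φ₁ p = dx 0 φ₂ p - s * I * dx 1 φ₂ p)
    (h₃ : ∀ p, dt φ₁ p - s * dx 2 φ₁ p = dx 0 φ₀ p + s * I * dx 1 φ₀ p)
    (h₄ : ∀ p, dt φ₂ p - s * dx 2 φ₂ p = dx 0 φ₁ p + s * I * dx 1 φ₁ p)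
    (w₀ : ∀ p, dt (dt φ₀) p = ∑ j, dx j (dx j φ₀) p)
    (w₁ : ∀ p, dt (dt φ₁) p = ∑ j, dx j (dx j φ₁) p)
    (w₂ : ∀ p, dt (dt φ₂) p = ∑ j, dx j (dx j φ₂) p)
    (hN : ∀ x, φ₁ (0, x) * φ₁ (0, x) - φ₀ (0, x) * φ₂ (0, x) = 0)
    (hN' : ∀ x, dt (fun p => φ₁ p * φ₁ p - φ₀ p * φ₂ p) (0, x) = 0)
    {x₀ : Vec3} (hx₀ : φ₀ (0, x₀) ≠ 0) (p : ℝ × Vec3) : φ₁ p * φ₁ p - φ₀ p * φ₂ p = 0 := by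
  have D : ∀ {g : ℝ × Vec3 → ℂ}, ContDiff ℝ ω g → ∀ p, DifferentiableAt ℝ g p :=
    fun hg p => hg.differentiable (by simp) p
  have et : dt (fun p => φ₁ p * φ₁ p - φ₀ p * φ₂ p) =
      fun p => φ₁ p * dt φ₁ p + dt φ₁ p * φ₁ p - (φ₀ p * dt φ₂ p + dt φ₀ p * φ₂ p) := by
    funext p
    rw [dt_sub ((D c₁ p).fun_mul (D c₁ p)) ((D c₀ p).fun_mul (D c₂ p)), dt_mul (D c₁ p) (D c₁ p),
      dt_mul (D c₀ p) (D c₂ p)]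
  have ex : ∀ j, dx j (fun p => φ₁ p * φ₁ p - φ₀ p * φ₂ p) =
      fun p => φ₁ p * dx j φ₁ p + dx j φ₁ p * φ₁ p - (φ₀ p * dx j φ₂ p + dx j φ₀ p * φ₂ p) := by
    intro j
    funext p
    rw [dx_sub j ((D c₁ p).fun_mul (D c₁ p)) ((D c₀ p).fun_mul (D c₂ p)),
      dx_mul j (D c₁ p) (D c₁ p), dx_mul j (D c₀ p) (D c₂ p)]
  have t₀ := contDiff_dt c₀
  have t₁ := contDiff_dt c₁
  have t₂ := contDiff_dt c₂
  have d₀ := contDiff_dx c₀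
  have d₁ := contDiff_dx c₁
  have d₂ := contDiff_dx c₂
  have ett : ∀ p, dt (dt (fun p => φ₁ p * φ₁ p - φ₀ p * φ₂ p)) p =
      2 * (φ₁ p * dt (dt φ₁) p + dt φ₁ p ^ 2) -
        (φ₀ p * dt (dt φ₂) p + dt (dt φ₀) p * φ₂ p + 2 * dt φ₀ p * dt φ₂ p) := by
    intro p
    rw [et, dt_sub (((D c₁ p).fun_mul (D t₁ p)).fun_add ((D t₁ p).fun_mul (D c₁ p)))
      (((D c₀ p).fun_mul (D t₂ p)).fun_add ((D t₀ p).fun_mul (D c₂ p))),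
      dt_add ((D c₁ p).fun_mul (D t₁ p)) ((D t₁ p).fun_mul (D c₁ p)),
      dt_add ((D c₀ p).fun_mul (D t₂ p)) ((D t₀ p).fun_mul (D c₂ p)),
      dt_mul (D c₁ p) (D t₁ p), dt_mul (D t₁ p) (D c₁ p), dt_mul (D c₀ p) (D t₂ p),
      dt_mul (D t₀ p) (D c₂ p)]
    ring
  have exx : ∀ j p, dx j (dx j (fun p => φ₁ p * φ₁ p - φ₀ p * φ₂ p)) p =
      2 * (φ₁ p * dx j (dx j φ₁) p + dx j φ₁ p ^ 2) -
        (φ₀ p * dx j (dx j φ₂) p + dx j (dx j φ₀) p * φ₂ p + 2 * dx j φ₀ p * dx j φ₂ p) := by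
    intro j p
    rw [ex, dx_sub j (((D c₁ p).fun_mul (D (d₁ j) p)).fun_add ((D (d₁ j) p).fun_mul (D c₁ p)))
      (((D c₀ p).fun_mul (D (d₂ j) p)).fun_add ((D (d₀ j) p).fun_mul (D c₂ p))),
      dx_add j ((D c₁ p).fun_mul (D (d₁ j) p)) ((D (d₁ j) p).fun_mul (D c₁ p)),
      dx_add j ((D c₀ p).fun_mul (D (d₂ j) p)) ((D (d₀ j) p).fun_mul (D c₂ p)),
      dx_mul j (D c₁ p) (D (d₁ j) p), dx_mul j (D (d₁ j) p) (D c₁ p),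
      dx_mul j (D c₀ p) (D (d₂ j) p), dx_mul j (D (d₀ j) p) (D c₂ p)]
    ring
  set U : Set Vec3 := {x | φ₀ (0, x) ≠ 0}
  have hU : IsOpen U := isOpen_ne_fun
    (c₀.continuous.comp (by fun_prop : Continuous fun x : Vec3 => ((0 : ℝ), x))) continuous_const
  have hcx : ∀ j, ContDiff ℝ ω ((![
      fun p => -3 * φ₀ p * (dx 0 φ₀ p + s * I * dx 1 φ₀ p) -
        φ₀ p * (dx 0 φ₀ p - s * I * dx 1 φ₀ p) + 2 * φ₁ p * (dt φ₀ p - s * dx 2 φ₀ p),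
      fun p => s * I * (3 * φ₀ p * (dx 0 φ₀ p + s * I * dx 1 φ₀ p) -
        φ₀ p * (dx 0 φ₀ p - s * I * dx 1 φ₀ p) - 2 * φ₁ p * (dt φ₀ p - s * dx 2 φ₀ p)),
      fun p => s * (-3 * φ₀ p * (dt φ₀ p + s * dx 2 φ₀ p) + φ₀ p * (dt φ₀ p - s * dx 2 φ₀ p) +
        2 * φ₁ p * (dx 0 φ₀ p - s * I * dx 1 φ₀ p))] : Fin 3 → ℝ × Vec3 → ℂ) j) := by
    intro j
    fin_cases j <;> simp <;> fun_prop
  -- The leading coefficient is `φ₀²`, nonzero initially over the open set `U`; zeros of `φ₀`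
  -- elsewhere do no harm.
  refine eq_zero_of_linear_wave (g := fun p => φ₁ p * φ₁ p - φ₀ p * φ₂ p) hU ⟨x₀, hx₀⟩
    (a := fun p => φ₀ p ^ 2)
    (ct := fun p => 3 * φ₀ p * (dt φ₀ p + s * dx 2 φ₀ p) + φ₀ p * (dt φ₀ p - s * dx 2 φ₀ p) -
      2 * φ₁ p * (dx 0 φ₀ p - s * I * dx 1 φ₀ p))
    (c := fun p => -4 * ((dt φ₀ p - s * dx 2 φ₀ p) * (dt φ₀ p + s * dx 2 φ₀ p) -
      (dx 0 φ₀ p - s * I * dx 1 φ₀ p) * (dx 0 φ₀ p + s * I * dx 1 φ₀ p)))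
    (by fun_prop) (by fun_prop) (by fun_prop) (by fun_prop) hcx (fun x hx => pow_ne_zero 2 hx)
    (fun p => ?_) (fun x _ => hN x) (fun x _ => hN' x) p
  have key := null_wave_identity s (φ₀ p) (φ₁ p) (φ₂ p) _ _ _ _ _ _ _ _ _ _ _ _ hs
    (h₁ p) (h₂ p) (h₃ p) (h₄ p)
  simp only [ett, exx, w₀, w₁, w₂]
  simp only [et, ex, Fin.sum_univ_three, Matrix.cons_val]
  linear_combination key

end NullWave

/-- Electromagnetic duality: results about the first field of a pair apply to the second. -/
theorem IsEvolution.rotate {e b : Fin 3 → ℝ × Vec3 → ℝ} (h : IsEvolution e b) :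
    IsEvolution b fun i p => -e i p := by
  refine ⟨h.contDiff_b, fun i => (h.contDiff_e i).neg, fun i p => ?_, fun i p => ?_⟩
  · rw [h.faraday, dx_neg, dx_neg]
    ring
  · simp only [dt_neg, h.ampere]

/-- The components of an analytic, divergence-free solution of Maxwell's evolution equations solve
the wave equation. -/
theorem IsEvolution.wave {e b : Fin 3 → ℝ × Vec3 → ℝ} (h : IsEvolution e b)
    (he : ∀ i, ContDiff ℝ ω (e i)) (hb : ∀ i, ContDiff ℝ ω (b i))
    (hdiv : ∀ p, ∑ i, dx i (e i) p = 0) (i : Fin 3) (p : ℝ × Vec3) :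
    dt (dt (e i)) p = ∑ j, dx j (dx j (e i)) p := by
  have D : ∀ {g : ℝ × Vec3 → ℝ}, ContDiff ℝ ω g → ∀ p, DifferentiableAt ℝ g p :=
    fun hg p => hg.differentiable (by simp) p
  have e1 : dt (e i) = fun p => dx (i + 1) (b (i + 2)) p - dx (i + 2) (b (i + 1)) p :=
    funext (h.ampere i)
  have e2 : ∀ i, dt (b i) = fun p => -(dx (i + 1) (e (i + 2)) p - dx (i + 2) (e (i + 1)) p) :=
    fun i => funext (h.faraday i)
  have e3 : ∀ j i, dx j (fun p => -(dx (i + 1) (e (i + 2)) p - dx (i + 2) (e (i + 1)) p)) p =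
      -(dx j (dx (i + 1) (e (i + 2))) p - dx j (dx (i + 2) (e (i + 1))) p) := fun j i => by
    simp only [dx_neg]
    rw [dx_sub j (D (contDiff_dx (he _) _) p) (D (contDiff_dx (he _) _) p)]
  rw [e1, dt_sub (D (contDiff_dx (hb _) _) p) (D (contDiff_dx (hb _) _) p), dt_dx_comm (hb _),
    dt_dx_comm (hb _), e2, e2, e3, e3]
  have hd : ∑ k, dx i (dx k (e k)) p = 0 := by
    rw [← dx_sum i fun k _ => D (contDiff_dx (he k) k) p]
    simp only [hdiv]
    simp [dx]
  simp only [Fin.sum_univ_three] at hd ⊢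
  fin_cases i
  · simp only [Fin.zero_eta, Fin.isValue, Fin.reduceAdd] at hd ⊢
    rw [dx_dx_comm (he 1) 1 0, dx_dx_comm (he 2) 2 0]
    linear_combination -hd
  · simp only [Fin.mk_one, Fin.isValue, Fin.reduceAdd] at hd ⊢
    rw [dx_dx_comm (he 0) 0 1, dx_dx_comm (he 2) 2 1]
    linear_combination -hd
  · simp only [Fin.reduceFinMk, Fin.isValue, Fin.reduceAdd] at hd ⊢
    rw [dx_dx_comm (he 0) 0 2, dx_dx_comm (he 1) 1 2]
    linear_combination -hd

/-! ### The Riemann–Silberstein field and its spinor components. -/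

section Complexification

open Complex

/-- The Riemann–Silberstein combination `u + i v`. -/
def complexify (u v : ℝ × Vec3 → ℝ) (p : ℝ × Vec3) : ℂ := (u p : ℂ) + I * (v p : ℂ)

theorem contDiff_complexify {u v : ℝ × Vec3 → ℝ} (hu : ContDiff ℝ ω u) (hv : ContDiff ℝ ω v) :
    ContDiff ℝ ω (complexify u v) := by
  have h : ContDiff ℝ ω (fun r : ℝ => (r : ℂ)) := ofRealCLM.contDiff
  exact (h.comp hu).add (contDiff_const.mul (h.comp hv))

theorem fderiv_complexify {u v : ℝ × Vec3 → ℝ} (hu : ContDiff ℝ ω u) (hv : ContDiff ℝ ω v)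
    (p w : ℝ × Vec3) :
    fderiv ℝ (complexify u v) p w = (fderiv ℝ u p w : ℂ) + I * (fderiv ℝ v p w : ℂ) := by
  have h1 := ofRealCLM.hasFDerivAt.comp p (hu.differentiable (by simp) p).hasFDerivAt
  have h2 := ofRealCLM.hasFDerivAt.comp p (hv.differentiable (by simp) p).hasFDerivAt
  exact congrFun (congrArg DFunLike.coe (h1.add (h2.const_mul I)).fderiv) w

theorem dt_complexify {u v : ℝ × Vec3 → ℝ} (hu : ContDiff ℝ ω u) (hv : ContDiff ℝ ω v) :
    dt (complexify u v) = complexify (dt u) (dt v) :=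
  funext fun p => fderiv_complexify hu hv p _

theorem dx_complexify {u v : ℝ × Vec3 → ℝ} (hu : ContDiff ℝ ω u) (hv : ContDiff ℝ ω v)
    (j : Fin 3) : dx j (complexify u v) = complexify (dx j u) (dx j v) :=
  funext fun p => fderiv_complexify hu hv p _

/-- A linear combination of two functions. -/
def linComb (c d : ℂ) (g h : ℝ × Vec3 → ℂ) (p : ℝ × Vec3) : ℂ := c * g p + d * h p

variable {g h : ℝ × Vec3 → ℂ}

theorem contDiff_linComb (c d : ℂ) (hg : ContDiff ℝ ω g) (hh : ContDiff ℝ ω h) :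
    ContDiff ℝ ω (linComb c d g h) := by
  unfold linComb
  fun_prop

theorem fderiv_linComb (c d : ℂ) (hg : ContDiff ℝ ω g) (hh : ContDiff ℝ ω h)
    (p w : ℝ × Vec3) :
    fderiv ℝ (linComb c d g h) p w = c * fderiv ℝ g p w + d * fderiv ℝ h p w := by
  have h1 := (hg.differentiable (by simp) p).hasFDerivAt.const_mul c
  have h2 := (hh.differentiable (by simp) p).hasFDerivAt.const_mul d
  exact congrFun (congrArg DFunLike.coe (h1.add h2).fderiv) w

theorem dt_linComb (c d : ℂ) (hg : ContDiff ℝ ω g) (hh : ContDiff ℝ ω h) :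
    dt (linComb c d g h) = linComb c d (dt g) (dt h) :=
  funext fun p => fderiv_linComb c d hg hh p _

theorem dx_linComb (c d : ℂ) (hg : ContDiff ℝ ω g) (hh : ContDiff ℝ ω h) (j : Fin 3) :
    dx j (linComb c d g h) = linComb c d (dx j g) (dx j h) :=
  funext fun p => fderiv_linComb c d hg hh p _

theorem wave_linComb (c d : ℂ) (hg : ContDiff ℝ ω g) (hh : ContDiff ℝ ω h)
    (wg : ∀ p, dt (dt g) p = ∑ j, dx j (dx j g) p) (wh : ∀ p, dt (dt h) p = ∑ j, dx j (dx j h) p)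
    (p : ℝ × Vec3) :
    dt (dt (linComb c d g h)) p = ∑ j, dx j (dx j (linComb c d g h)) p := by
  rw [dt_linComb c d hg hh, dt_linComb c d (contDiff_dt hg) (contDiff_dt hh)]
  simp only [dx_linComb c d hg hh, dx_linComb c d (contDiff_dx hg _) (contDiff_dx hh _)]
  simp only [linComb, wg, wh, Finset.mul_sum, ← Finset.sum_add_distrib]

theorem wave_complexify {u v : ℝ × Vec3 → ℝ} (hu : ContDiff ℝ ω u) (hv : ContDiff ℝ ω v)
    (wu : ∀ p, dt (dt u) p = ∑ j, dx j (dx j u) p) (wv : ∀ p, dt (dt v) p = ∑ j, dx j (dx j v) p)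
    (p : ℝ × Vec3) :
    dt (dt (complexify u v)) p = ∑ j, dx j (dx j (complexify u v)) p := by
  rw [dt_complexify hu hv, dt_complexify (contDiff_dt hu) (contDiff_dt hv)]
  simp only [dx_complexify hu hv, dx_complexify (contDiff_dx hu _) (contDiff_dx hv _)]
  simp only [complexify, wu, wv, ofReal_sum, Finset.mul_sum, ← Finset.sum_add_distrib]

/-- A complex null vector with `F₀ = i F₁` and `F₀ = -i F₁` vanishes. -/
theorem exists_spinor_component_ne_zero {F₀ F₁ F₂ : ℂ} (hN : F₀ * F₀ + F₁ * F₁ + F₂ * F₂ = 0)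
    (h : ¬(F₀ = 0 ∧ F₁ = 0 ∧ F₂ = 0)) : ∃ s : ℂ, s ^ 2 = 1 ∧ F₀ + -(s * I) * F₁ ≠ 0 := by
  by_contra! hs
  have h1 := hs 1 (by norm_num)
  have h2 := hs (-1) (by norm_num)
  have h0 : F₀ = 0 := by linear_combination (h1 + h2) / 2
  have h3 : F₁ = 0 := by linear_combination (I / 2) * (h1 - h2) + F₁ * I_sq
  refine h ⟨h0, h3, ?_⟩
  rw [h0, h3] at hN
  exact mul_self_eq_zero.1 (by linear_combination hN)

/-- An analytic Maxwell field which is null to first order on the initial surface is null. -/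
theorem IsEvolution.null {e b : Fin 3 → ℝ × Vec3 → ℝ} (h : IsEvolution e b)
    (he : ∀ i, ContDiff ℝ ω (e i)) (hb : ∀ i, ContDiff ℝ ω (b i))
    (hdive : ∀ p, ∑ i, dx i (e i) p = 0) (hdivb : ∀ p, ∑ i, dx i (b i) p = 0)
    (h₁ : ∀ x, ∑ i, e i (0, x) * b i (0, x) = 0)
    (h₂ : ∀ x, ∑ i, e i (0, x) * e i (0, x) = ∑ i, b i (0, x) * b i (0, x))
    (h₃ : ∀ x, ∑ i, (e i (0, x) * dt (e i) (0, x) - b i (0, x) * dt (b i) (0, x)) = 0)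
    (h₄ : ∀ x, ∑ i, (e i (0, x) * dt (b i) (0, x) + b i (0, x) * dt (e i) (0, x)) = 0)
    (p : ℝ × Vec3) :
    ∑ i, e i p * b i p = 0 ∧ ∑ i, e i p * e i p = ∑ i, b i p * b i p := by
  -- With zero data no spinor component is available to divide by, but uniqueness makes the whole
  -- field zero.
  by_cases hz : ∀ x i, e i (0, x) = 0 ∧ b i (0, x) = 0
  · have := fun i => h.eq_zero (fun i x => (hz x i).1) (fun i x => (hz x i).2) i p
    simp [fun i => (this i).1, fun i => (this i).2]
  have we := h.wave he hb hdive
  have wb := h.rotate.wave hb (fun i => (he i).neg) hdivb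
  set F : Fin 3 → ℝ × Vec3 → ℂ := fun i => complexify (e i) (b i) with hF
  have cF : ∀ i, ContDiff ℝ ω (F i) := fun i => contDiff_complexify (he i) (hb i)
  have wF : ∀ i p, dt (dt (F i)) p = ∑ j, dx j (dx j (F i)) p := fun i =>
    wave_complexify (he i) (hb i) (we i) (wb i)
  have dtF : ∀ i p, dt (F i) p = complexify (dt (e i)) (dt (b i)) p := fun i p =>
    congrFun (dt_complexify (he i) (hb i)) p
  have dxF : ∀ i j p, dx j (F i) p = complexify (dx j (e i)) (dx j (b i)) p := fun i j p =>
    congrFun (dx_complexify (he i) (hb i) j) p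
  -- Here and in `a₁`, `a₂`: the components of `∂ₜF = -i curl F`.
  have a₀ : ∀ p, dt (F 0) p = -I * (dx 1 (F 2) p - dx 2 (F 1) p) := fun p => by
    have h1 : dt (e 0) p = dx 1 (b 2) p - dx 2 (b 1) p := h.ampere 0 p
    have h2 : dt (b 0) p = -(dx 1 (e 2) p - dx 2 (e 1) p) := h.faraday 0 p
    simp only [dtF, dxF, complexify, h1, h2]
    push_cast
    linear_combination (((dx 1 (b 2) p : ℝ) : ℂ) - ((dx 2 (b 1) p : ℝ) : ℂ)) * I_sq
  have a₁ : ∀ p, dt (F 1) p = -I * (dx 2 (F 0) p - dx 0 (F 2) p) := fun p => by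
    have h1 : dt (e 1) p = dx 2 (b 0) p - dx 0 (b 2) p := h.ampere 1 p
    have h2 : dt (b 1) p = -(dx 2 (e 0) p - dx 0 (e 2) p) := h.faraday 1 p
    simp only [dtF, dxF, complexify, h1, h2]
    push_cast
    linear_combination (((dx 2 (b 0) p : ℝ) : ℂ) - ((dx 0 (b 2) p : ℝ) : ℂ)) * I_sq
  have a₂ : ∀ p, dt (F 2) p = -I * (dx 0 (F 1) p - dx 1 (F 0) p) := fun p => by
    have h1 : dt (e 2) p = dx 0 (b 1) p - dx 1 (b 0) p := h.ampere 2 p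
    have h2 : dt (b 2) p = -(dx 0 (e 1) p - dx 1 (e 0) p) := h.faraday 2 p
    simp only [dtF, dxF, complexify, h1, h2]
    push_cast
    linear_combination (((dx 0 (b 1) p : ℝ) : ℂ) - ((dx 1 (b 0) p : ℝ) : ℂ)) * I_sq
  have dF : ∀ p, dx 0 (F 0) p + dx 1 (F 1) p + dx 2 (F 2) p = 0 := fun p => by
    have h1 := congrArg (fun r : ℝ => (r : ℂ)) (hdive p)
    have h2 := congrArg (fun r : ℝ => (r : ℂ)) (hdivb p)
    simp only [Fin.sum_univ_three] at h1 h2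
    push_cast at h1 h2
    simp only [dxF, complexify]
    linear_combination h1 + I * h2
  have sq : ∀ p, F 0 p * F 0 p + F 1 p * F 1 p + F 2 p * F 2 p =
      ((∑ i, e i p * e i p - ∑ i, b i p * b i p : ℝ) : ℂ) +
        I * ((2 * ∑ i, e i p * b i p : ℝ) : ℂ) := fun p => by
    simp only [hF, complexify, Fin.sum_univ_three]
    push_cast
    linear_combination (b 0 p ^ 2 + b 1 p ^ 2 + b 2 p ^ 2 : ℂ) * I_sq
  have N0 : ∀ x, F 0 (0, x) * F 0 (0, x) + F 1 (0, x) * F 1 (0, x) + F 2 (0, x) * F 2 (0, x)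
      = 0 := fun x => by
    rw [sq, h₁, h₂]
    simp
  -- This is half of `∂ₜ(F·F)` at time zero, with real part `h₃` and imaginary part `h₄`.
  have N1 : ∀ x, F 0 (0, x) * dt (F 0) (0, x) + F 1 (0, x) * dt (F 1) (0, x) +
      F 2 (0, x) * dt (F 2) (0, x) = 0 := fun x => by
    have h3 := congrArg (fun r : ℝ => (r : ℂ)) (h₃ x)
    have h4 := congrArg (fun r : ℝ => (r : ℂ)) (h₄ x)
    simp only [Fin.sum_univ_three] at h3 h4
    push_cast at h3 h4
    simp only [dtF]
    simp only [hF, complexify]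
    linear_combination h3 + I * h4 + (b 0 (0, x) * ((dt (b 0) (0, x) : ℝ) : ℂ) +
      b 1 (0, x) * ((dt (b 1) (0, x) : ℝ) : ℂ) + b 2 (0, x) * ((dt (b 2) (0, x) : ℝ) : ℂ)) * I_sq
  obtain ⟨x₀, hx₀⟩ : ∃ x₀, ¬(F 0 (0, x₀) = 0 ∧ F 1 (0, x₀) = 0 ∧ F 2 (0, x₀) = 0) := by
    by_contra hall
    refine hz fun x i => ?_
    have hi : F i (0, x) = 0 := by
      obtain ⟨h0, h1, h2⟩ := not_not.1 (not_exists.1 hall x)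
      fin_cases i
      exacts [h0, h1, h2]
    have := Complex.ext_iff.1 hi
    simpa [hF, complexify] using this
  -- The sign `s = ±1` orients the third axis. A nonzero null vector has `F₀ - s i F₁ ≠ 0` for one
  -- of the two signs, and this component serves as `φ₀`.
  obtain ⟨s, hs, hne⟩ := exists_spinor_component_ne_zero (N0 x₀) hx₀
  -- With `φ₀ = F₀ - s i F₁`, `φ₁ = s F₂`, `φ₂ = -F₀ - s i F₁`, the quantity `φ₁² - φ₀φ₂` is `F·F`.
  have hsq : ∀ p, linComb s 0 (F 2) (F 2) p * linComb s 0 (F 2) (F 2) p -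
      linComb 1 (-(s * I)) (F 0) (F 1) p * linComb (-1) (-(s * I)) (F 0) (F 1) p =
      F 0 p * F 0 p + F 1 p * F 1 p + F 2 p * F 2 p := fun p => by
    simp only [linComb]
    linear_combination (F 2 p ^ 2 + F 1 p ^ 2) * hs - F 1 p ^ 2 * s ^ 2 * I_sq
  have key := null_of_spinor_components hs
    (φ₀ := linComb 1 (-(s * I)) (F 0) (F 1)) (φ₁ := linComb s 0 (F 2) (F 2))
    (φ₂ := linComb (-1) (-(s * I)) (F 0) (F 1))
    (contDiff_linComb _ _ (cF _) (cF _)) (contDiff_linComb _ _ (cF _) (cF _))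
    (contDiff_linComb _ _ (cF _) (cF _))
    (fun p => by
      simp only [dt_linComb _ _ (cF _) (cF _), dx_linComb _ _ (cF _) (cF _)]
      simp only [linComb, a₀, a₁]
      linear_combination s * (dx 2 (F 0) p - dx 0 (F 2) p) * I_sq +
        I * (dx 1 (F 2) p - dx 2 (F 1) p) * hs)
    (fun p => by
      simp only [dt_linComb _ _ (cF _) (cF _), dx_linComb _ _ (cF _) (cF _)]
      simp only [linComb, a₂]
      linear_combination dF p + (dx 2 (F 2) p + dx 1 (F 1) p) * hs -
        dx 1 (F 1) p * s ^ 2 * I_sq)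
    (fun p => by
      simp only [dt_linComb _ _ (cF _) (cF _), dx_linComb _ _ (cF _) (cF _)]
      simp only [linComb, a₂]
      linear_combination -dF p - (dx 2 (F 2) p + dx 1 (F 1) p) * hs +
        dx 1 (F 1) p * s ^ 2 * I_sq)
    (fun p => by
      simp only [dt_linComb _ _ (cF _) (cF _), dx_linComb _ _ (cF _) (cF _)]
      simp only [linComb, a₀, a₁]
      linear_combination s * (dx 2 (F 0) p - dx 0 (F 2) p) * I_sq +
        I * (dx 2 (F 1) p - dx 1 (F 2) p) * hs)
    (wave_linComb _ _ (cF _) (cF _) (wF _) (wF _)) (wave_linComb _ _ (cF _) (cF _) (wF _) (wF _))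
    (wave_linComb _ _ (cF _) (cF _) (wF _) (wF _))
    (fun x => by rw [hsq, N0])
    (fun x => by
      have D : ∀ i, DifferentiableAt ℝ (F i) (0, x) := fun i => (cF i).differentiable (by simp) _
      simp only [hsq]
      rw [dt_add (((D 0).fun_mul (D 0)).fun_add ((D 1).fun_mul (D 1))) ((D 2).fun_mul (D 2)),
        dt_add ((D 0).fun_mul (D 0)) ((D 1).fun_mul (D 1)), dt_mul (D 0) (D 0),
        dt_mul (D 1) (D 1), dt_mul (D 2) (D 2)]
      linear_combination 2 * N1 x)
    (x₀ := x₀) (by simpa [linComb] using hne) p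
  rw [hsq, sq] at key
  have hre := congrArg re key
  have him := congrArg im key
  simp only [add_re, add_im, mul_re, mul_im, ofReal_re, ofReal_im, I_re, I_im, zero_re, zero_im]
    at hre him
  constructor <;> linarith

end Complexification

/-! ### The shear of the Poynting field in terms of curls. -/

section Shear

theorem fderiv_dotProduct_apply {X Y : Vec3 → Vec3} {x : Vec3} (hX : DifferentiableAt ℝ X x)
    (hY : DifferentiableAt ℝ Y x) (j : Fin 3) :
    fderiv ℝ (fun y => X y ⬝ᵥ Y y) x (Pi.single j 1) =
      ∑ i, (X x i * pderiv Y j i x + pderiv X j i x * Y x i) := by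
  have h1 := fun i => (hasFDerivAt_pi'.1 hX.hasFDerivAt) i
  have h2 := fun i => (hasFDerivAt_pi'.1 hY.hasFDerivAt) i
  have h3 := HasFDerivAt.fun_sum (u := Finset.univ) fun i _ => (h1 i).mul (h2 i)
  refine (congrFun (congrArg DFunLike.coe h3.fderiv) _).trans ?_
  simp [pderiv, mul_comm]

variable {E B V : Vec3 → Vec3}

theorem energyDensity_eq_zero_iff {x : Vec3} :
    energyDensity E B x = 0 ↔ E x = 0 ∧ B x = 0 := by
  have hE : 0 ≤ E x ⬝ᵥ E x := Finset.sum_nonneg fun i _ => mul_self_nonneg _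
  have hB : 0 ≤ B x ⬝ᵥ B x := Finset.sum_nonneg fun i _ => mul_self_nonneg _
  rw [← dotProduct_self_eq_zero (v := E x), ← dotProduct_self_eq_zero (v := B x), energyDensity]
  constructor
  · intro h
    constructor <;> linarith
  · rintro ⟨h1, h2⟩
    rw [h1, h2]
    norm_num

/-- For null data the two shear components of the Poynting field are the real and imaginary parts
of `-i F · curl F`, where `F = E + i B`. -/
theorem shear_eq (hE : Differentiable ℝ E) (hB : Differentiable ℝ B)
    (hV : IsNormalizedPoynting E B V) (hnull : IsNull E B) (x : Vec3) :
    ∑ i, ∑ j, (E x i * E x j - B x i * B x j) * pderiv V j i x =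
      E x ⬝ᵥ curl B x + B x ⬝ᵥ curl E x ∧
    ∑ i, ∑ j, (E x i * B x j + E x j * B x i) * pderiv V j i x =
      B x ⬝ᵥ curl B x - E x ⬝ᵥ curl E x := by
  by_cases hW : energyDensity E B x = 0
  · obtain ⟨h1, h2⟩ := energyDensity_eq_zero_iff.1 hW
    simp [h1, h2]
  have hVd : Differentiable ℝ V := hV.smooth.differentiable (by simp)
  have hWc : Continuous (energyDensity E B) := by
    have h1 := hE.continuous
    have h2 := hB.continuous
    unfold energyDensity dotProduct
    fun_prop
  have hWn : ∀ᶠ y in 𝓝 x, energyDensity E B y ≠ 0 := hWc.continuousAt.eventually_ne hW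
  -- Near a point with `W ≠ 0`, `V` is orthogonal to `E` and `B`. Differentiating this moves
  -- derivatives off `V`: `Eⁱ ∂ⱼVᵢ = -Vᵢ ∂ⱼEᵢ`, and likewise for `B`.
  have hVE : (fun y => V y ⬝ᵥ E y) =ᶠ[𝓝 x] fun _ => 0 := by
    filter_upwards [hWn] with y hy
    have := congrArg (· ⬝ᵥ E y) (hV.energyDensity_smul y)
    simp only [smul_dotProduct, smul_eq_mul] at this
    rw [dotProduct_comm (E y ⨯₃ B y), dot_self_cross] at this
    exact (mul_eq_zero.1 this).resolve_left hy
  have hVB : (fun y => V y ⬝ᵥ B y) =ᶠ[𝓝 x] fun _ => 0 := by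
    filter_upwards [hWn] with y hy
    have := congrArg (· ⬝ᵥ B y) (hV.energyDensity_smul y)
    simp only [smul_dotProduct, smul_eq_mul] at this
    rw [dotProduct_comm (E y ⨯₃ B y), dot_cross_self] at this
    exact (mul_eq_zero.1 this).resolve_left hy
  have dVE : ∀ j, ∑ i, (V x i * pderiv E j i x + pderiv V j i x * E x i) = 0 := fun j => by
    rw [← fderiv_dotProduct_apply (hVd x) (hE x), hVE.fderiv_eq]
    simp
  have dVB : ∀ j, ∑ i, (V x i * pderiv B j i x + pderiv V j i x * B x i) = 0 := fun j => by
    rw [← fderiv_dotProduct_apply (hVd x) (hB x), hVB.fderiv_eq]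
    simp
  have dEB : ∀ j, ∑ i, (E x i * pderiv B j i x + pderiv E j i x * B x i) = 0 := fun j => by
    rw [← fderiv_dotProduct_apply (hE x) (hB x), funext fun y => (hnull y).1]
    simp
  have dEE : ∀ j, ∑ i, (E x i * pderiv E j i x + pderiv E j i x * E x i) =
      ∑ i, (B x i * pderiv B j i x + pderiv B j i x * B x i) := fun j => by
    rw [← fderiv_dotProduct_apply (hE x) (hE x), ← fderiv_dotProduct_apply (hB x) (hB x),
      funext fun y => (hnull y).2]
  obtain ⟨n1, n2⟩ := hnull x
  have c := hV.energyDensity_smul x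
  rw [cross_apply] at c
  have c0 := congrFun c 0
  have c1 := congrFun c 1
  have c2 := congrFun c 2
  have VE0 := dVE 0
  have VE1 := dVE 1
  have VE2 := dVE 2
  have VB0 := dVB 0
  have VB1 := dVB 1
  have VB2 := dVB 2
  have EB0 := dEB 0
  have EB1 := dEB 1
  have EB2 := dEB 2
  have EE0 := dEE 0
  have EE1 := dEE 1
  have EE2 := dEE 2
  clear dVE dVB dEB dEE hVE hVB
  simp only [Pi.smul_apply, smul_eq_mul, Matrix.cons_val] at c0 c1 c2
  -- After multiplication by `W`, every `W V` can be replaced by `E × B`, leaving a polynomial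
  -- identity in the fields and their first derivatives.
  refine ⟨mul_left_cancel₀ hW ?_, mul_left_cancel₀ hW ?_⟩
  all_goals
    simp only [energyDensity, dotProduct, curl, Fin.sum_univ_three, Matrix.cons_val] at *
    generalize E x 0 = e0 at *
    generalize E x 1 = e1 at *
    generalize E x 2 = e2 at *
    generalize B x 0 = b0 at *
    generalize B x 1 = b1 at *
    generalize B x 2 = b2 at *
    generalize V x 0 = v0 at *
    generalize V x 1 = v1 at *
    generalize V x 2 = v2 at *
    generalize hw : (e0 * e0 + e1 * e1 + e2 * e2 + (b0 * b0 + b1 * b1 + b2 * b2)) / 2 = w at *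
    set E00 := pderiv E 0 0 x
    set E01 := pderiv E 0 1 x
    set E02 := pderiv E 0 2 x
    set E10 := pderiv E 1 0 x
    set E11 := pderiv E 1 1 x
    set E12 := pderiv E 1 2 x
    set E20 := pderiv E 2 0 x
    set E21 := pderiv E 2 1 x
    set E22 := pderiv E 2 2 x
    set B00 := pderiv B 0 0 x
    set B01 := pderiv B 0 1 x
    set B02 := pderiv B 0 2 x
    set B10 := pderiv B 1 0 x
    set B11 := pderiv B 1 1 x
    set B12 := pderiv B 1 2 x
    set B20 := pderiv B 2 0 x
    set B21 := pderiv B 2 1 x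
    set B22 := pderiv B 2 2 x
  -- `VE`, `VB` remove the derivatives of `V`, `c0`–`c2` replace `W V`, and the differentiated null
  -- condition `EE` turns directional derivatives into curls. The remaining terms reduce by nullity
  -- `n1`, `n2` and the definition of `W`.
  · linear_combination w * (e0 * VE0 + e1 * VE1 + e2 * VE2) - w * (b0 * VB0 + b1 * VB1 + b2 * VB2)
      - (e0 * E00 + e1 * E10 + e2 * E20 - b0 * B00 - b1 * B10 - b2 * B20) * c0
      - (e0 * E01 + e1 * E11 + e2 * E21 - b0 * B01 - b1 * B11 - b2 * B21) * c1
      - (e0 * E02 + e1 * E12 + e2 * E22 - b0 * B02 - b1 * B12 - b2 * B22) * c2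
      - ((e1 * b2 - e2 * b1) * EE0 + (e2 * b0 - e0 * b2) * EE1 + (e0 * b1 - e1 * b0) * EE2) / 2
      + (b0 * (E12 - E21) + b1 * (E20 - E02) + b2 * (E01 - E10)
        - e0 * (B12 - B21) - e1 * (B20 - B02) - e2 * (B01 - B10)) / 2 * n2
      - (e0 * (E12 - E21) + e1 * (E20 - E02) + e2 * (E01 - E10)
        + b0 * (B12 - B21) + b1 * (B20 - B02) + b2 * (B01 - B10)) * n1
      + (e0 * (B12 - B21) + e1 * (B20 - B02) + e2 * (B01 - B10)
        + b0 * (E12 - E21) + b1 * (E20 - E02) + b2 * (E01 - E10)) * hw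
  · linear_combination w * (b0 * VE0 + b1 * VE1 + b2 * VE2) + w * (e0 * VB0 + e1 * VB1 + e2 * VB2)
      - (b0 * E00 + b1 * E10 + b2 * E20 + e0 * B00 + e1 * B10 + e2 * B20) * c0
      - (b0 * E01 + b1 * E11 + b2 * E21 + e0 * B01 + e1 * B11 + e2 * B21) * c1
      - (b0 * E02 + b1 * E12 + b2 * E22 + e0 * B02 + e1 * B12 + e2 * B22) * c2
      - ((e1 * b2 - e2 * b1) * EB0 + (e2 * b0 - e0 * b2) * EB1 + (e0 * b1 - e1 * b0) * EB2)
      + (b0 * (B12 - B21) + b1 * (B20 - B02) + b2 * (B01 - B10)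
        + e0 * (E12 - E21) + e1 * (E20 - E02) + e2 * (E01 - E10)) / 2 * n2
      + (b0 * (E12 - E21) + b1 * (E20 - E02) + b2 * (E01 - E10)
        - e0 * (B12 - B21) - e1 * (B20 - B02) - e2 * (B01 - B10)) * n1
      + (b0 * (B12 - B21) + b1 * (B20 - B02) + b2 * (B01 - B10)
        - e0 * (E12 - E21) - e1 * (E20 - E02) - e2 * (E01 - E10)) * hw

end Shear

/-! ### From vector fields to component functions on space-time. -/

section Components

/-- The `i`-th component of a time-dependent vector field, as a function on space-time. -/
def component (E : ℝ → Vec3 → Vec3) (i : Fin 3) (p : ℝ × Vec3) : ℝ := E p.1 p.2 i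

variable {E B : ℝ → Vec3 → Vec3}

theorem contDiff_component (hE : ContDiff ℝ 1 fun p : ℝ × Vec3 => E p.1 p.2) (i : Fin 3) :
    ContDiff ℝ 1 (component E i) :=
  contDiff_pi.1 hE i

theorem fderiv_component (hE : ContDiff ℝ 1 fun p : ℝ × Vec3 => E p.1 p.2) (i : Fin 3)
    (p v : ℝ × Vec3) :
    fderiv ℝ (component E i) p v = fderiv ℝ (fun p : ℝ × Vec3 => E p.1 p.2) p v i := by
  have h := (hasFDerivAt_pi'.1 (hE.differentiable one_ne_zero p).hasFDerivAt) i
  exact congrFun (congrArg DFunLike.coe h.fderiv) v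

theorem dt_component (hE : ContDiff ℝ 1 fun p : ℝ × Vec3 => E p.1 p.2) (i : Fin 3)
    (t : ℝ) (x : Vec3) : dt (component E i) (t, x) = deriv (fun s => E s x) t i := by
  rw [dt, fderiv_component hE,
    (hasDerivAt_time (hE.differentiable one_ne_zero (t, x))).deriv]
  rfl

theorem dx_component (hE : ContDiff ℝ 1 fun p : ℝ × Vec3 => E p.1 p.2) (i j : Fin 3)
    (t : ℝ) (x : Vec3) : dx j (component E i) (t, x) = pderiv (E t) j i x := by
  rw [dx, fderiv_component hE, pderiv]
  have h := (hE.differentiable one_ne_zero (t, x)).hasFDerivAt.comp x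
    (hasFDerivAt_prodMk_right (𝕜 := ℝ) t x)
  have h2 := congrFun (congrArg DFunLike.coe h.fderiv) (Pi.single j 1)
  exact (congrFun h2 i).symm

theorem curl_apply (X : Vec3 → Vec3) (i : Fin 3) (x : Vec3) :
    curl X x i = pderiv X (i + 1) (i + 2) x - pderiv X (i + 2) (i + 1) x := by
  fin_cases i <;> rfl

theorem IsMaxwellSolution.isEvolution (h : IsMaxwellSolution E B) :
    IsEvolution (component E) (component B) := by
  refine ⟨contDiff_component h.contDiff_E, contDiff_component h.contDiff_B, ?_, ?_⟩
  · rintro i ⟨t, x⟩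
    rw [dt_component h.contDiff_E, h.ampere, curl_apply, dx_component h.contDiff_B,
      dx_component h.contDiff_B]
  · rintro i ⟨t, x⟩
    rw [dt_component h.contDiff_B, h.faraday, Pi.neg_apply, curl_apply, dx_component h.contDiff_E,
      dx_component h.contDiff_E]

/-- The left side is half of `∂ₜ(|E|² - |B|²)`; the companion `sum_mul_dt_add` treats `∂ₜ(E·B)`. -/
theorem IsMaxwellSolution.sum_mul_dt_sub (h : IsMaxwellSolution E B) (t : ℝ) (x : Vec3) :
    ∑ i, (component E i (t, x) * dt (component E i) (t, x) -
      component B i (t, x) * dt (component B i) (t, x)) =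
    E t x ⬝ᵥ curl (B t) x + B t x ⬝ᵥ curl (E t) x := by
  simp only [dt_component h.contDiff_E, dt_component h.contDiff_B, h.ampere, h.faraday, component,
    dotProduct, ← Finset.sum_add_distrib]
  exact Finset.sum_congr rfl fun i _ => by rw [Pi.neg_apply]; ring

theorem IsMaxwellSolution.sum_mul_dt_add (h : IsMaxwellSolution E B) (t : ℝ) (x : Vec3) :
    ∑ i, (component E i (t, x) * dt (component B i) (t, x) +
      component B i (t, x) * dt (component E i) (t, x)) =
    B t x ⬝ᵥ curl (B t) x - E t x ⬝ᵥ curl (E t) x := by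
  simp only [dt_component h.contDiff_E, dt_component h.contDiff_B, h.ampere, h.faraday, component,
    dotProduct, ← Finset.sum_sub_distrib]
  exact Finset.sum_congr rfl fun i _ => by rw [Pi.neg_apply]; ring

theorem IsMaxwellSolution.div_E (h : IsMaxwellSolution E B) (p : ℝ × Vec3) :
    ∑ i, dx i (component E i) p = 0 := by
  obtain ⟨t, x⟩ := p
  simp only [dx_component h.contDiff_E]
  exact h.gauss_E t x

theorem IsMaxwellSolution.div_B (h : IsMaxwellSolution E B) (p : ℝ × Vec3) :
    ∑ i, dx i (component B i) p = 0 := by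
  obtain ⟨t, x⟩ := p
  simp only [dx_component h.contDiff_B]
  exact h.gauss_B t x

theorem spd_apply {X : Vec3 → Vec3} {x : Vec3} (hX : DifferentiableAt ℝ X x) (i j : Fin 3) :
    spd j (fun x => X x i) x = pderiv X j i x :=
  congrFun (congrArg DFunLike.coe ((hasFDerivAt_pi'.1 hX.hasFDerivAt) i).fderiv) (Pi.single j 1)

/-- If a Maxwell field is null at all times, the first-order obstruction `F · curl F` vanishes. -/
theorem IsMaxwellSolution.curl_eq_zero_of_null (h : IsMaxwellSolution E B)
    (hnull : ∀ t, IsNull (E t) (B t)) (t : ℝ) (x : Vec3) :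
    E t x ⬝ᵥ curl (B t) x + B t x ⬝ᵥ curl (E t) x = 0 ∧
    B t x ⬝ᵥ curl (B t) x - E t x ⬝ᵥ curl (E t) x = 0 := by
  have hE : ∀ i, HasDerivAt (fun s => component E i (s, x)) (dt (component E i) (t, x)) t :=
    fun i => hasDerivAt_time ((contDiff_component h.contDiff_E i).differentiable one_ne_zero _)
  have hB : ∀ i, HasDerivAt (fun s => component B i (s, x)) (dt (component B i) (t, x)) t :=
    fun i => hasDerivAt_time ((contDiff_component h.contDiff_B i).differentiable one_ne_zero _)
  rw [← h.sum_mul_dt_sub, ← h.sum_mul_dt_add]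
  constructor
  · have h1 := HasDerivAt.fun_sum (u := Finset.univ) fun i _ =>
      ((hE i).mul (hE i)).sub ((hB i).mul (hB i))
    have h2 : HasDerivAt (fun s => ∑ i, (component E i (s, x) * component E i (s, x) -
        component B i (s, x) * component B i (s, x))) 0 t := by
      have : (fun s => ∑ i, (component E i (s, x) * component E i (s, x) -
          component B i (s, x) * component B i (s, x))) = fun _ => 0 := by
        funext s
        rw [Finset.sum_sub_distrib]
        exact sub_eq_zero.2 (hnull s x).2
      rw [this]
      exact hasDerivAt_const t 0
    have h3 := h1.unique h2
    rw [← mul_right_inj' (two_ne_zero (α := ℝ)), mul_zero, Finset.mul_sum, ← h3]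
    exact Finset.sum_congr rfl fun i _ => by ring
  · have h1 := HasDerivAt.fun_sum (u := Finset.univ) fun i _ => (hE i).mul (hB i)
    have h2 : HasDerivAt (fun s => ∑ i, component E i (s, x) * component B i (s, x)) 0 t := by
      have : (fun s => ∑ i, component E i (s, x) * component B i (s, x)) = fun _ => 0 :=
        funext fun s => (hnull s x).1
      rw [this]
      exact hasDerivAt_const t 0
    have h3 := h1.unique h2
    rw [← h3]
    exact Finset.sum_congr rfl fun i _ => by ring

end Components

end

end Maxwell

theorem mainTheorem1
    (E B : ℝ → Maxwell.Vec3 → Maxwell.Vec3)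
    (E₀ B₀ V₀ : Maxwell.Vec3 → Maxwell.Vec3)
    (hEB : Maxwell.IsMaxwellSolution E B)
    (hE₀ : E 0 = E₀) (hB₀ : B 0 = B₀)
    (hE₀_analytic : AnalyticOnNhd ℝ E₀ Set.univ)
    (hB₀_analytic : AnalyticOnNhd ℝ B₀ Set.univ)
    (hV₀ : Maxwell.IsNormalizedPoynting E₀ B₀ V₀) :
    (∀ t, Maxwell.IsNull (E t) (B t)) ↔
      ((∀ x, Maxwell.divergence E₀ x = 0 ∧ Maxwell.divergence B₀ x = 0) ∧
        Maxwell.IsNull E₀ B₀ ∧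
        Maxwell.IsShearFree E₀ B₀ V₀) := by
  subst hE₀ hB₀
  have hcE : ContDiff ℝ ω (E 0) := contDiff_omega_iff_analyticOnNhd.2 hE₀_analytic
  have hcB : ContDiff ℝ ω (B 0) := contDiff_omega_iff_analyticOnNhd.2 hB₀_analytic
  have hdE : Differentiable ℝ (E 0) := hcE.differentiable (by simp)
  have hdB : Differentiable ℝ (B 0) := hcB.differentiable (by simp)
  constructor
  · intro hnull
    refine ⟨fun x => ⟨hEB.gauss_E 0 x, hEB.gauss_B 0 x⟩, hnull 0, fun x => ?_⟩
    obtain ⟨h1, h2⟩ := Maxwell.shear_eq hdE hdB hV₀ (hnull 0) x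
    obtain ⟨h3, h4⟩ := hEB.curl_eq_zero_of_null hnull 0 x
    exact ⟨h1.trans h3, h2.trans h4⟩
  · rintro ⟨-, hnull, hshear⟩ t x
    -- Shear-freeness, read through `shear_eq`, says that nullity holds to first order in time at `t
    -- = 0`.
    have hfirst : ∀ x, E 0 x ⬝ᵥ Maxwell.curl (B 0) x + B 0 x ⬝ᵥ Maxwell.curl (E 0) x = 0 ∧
        B 0 x ⬝ᵥ Maxwell.curl (B 0) x - E 0 x ⬝ᵥ Maxwell.curl (E 0) x = 0 := fun x => by
      obtain ⟨h1, h2⟩ := Maxwell.shear_eq hdE hdB hV₀ hnull x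
      exact ⟨h1.symm.trans (hshear x).1, h2.symm.trans (hshear x).2⟩
    have hev := hEB.isEvolution
    have hω := hev.contDiff_omega (f := fun i x => E 0 x i) (g := fun i x => B 0 x i)
      (contDiff_pi.1 hcE) (contDiff_pi.1 hcB) (fun _ _ => rfl) (fun _ _ => rfl)
      (fun x => by
        simp only [Maxwell.spd_apply (hdE x)]
        exact hEB.gauss_E 0 x)
      (fun x => by
        simp only [Maxwell.spd_apply (hdB x)]
        exact hEB.gauss_B 0 x)
    exact hev.null (fun i => (hω i).1) (fun i => (hω i).2) hEB.div_E hEB.div_B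
      (fun x => (hnull x).1) (fun x => (hnull x).2)
      (fun x => (hEB.sum_mul_dt_sub 0 x).trans (hfirst x).1)
      (fun x => (hEB.sum_mul_dt_add 0 x).trans (hfirst x).2) (t, x)
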